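/- Let $\mathcal{H}_A$ be a complex Hilbert space, let $d\ge 0$, $n\ge 1$ and $0\le k\le n$ be integers, and let $\xi^{An}$ be a state (a positive operator of trace one) on $\mathcal{H}_A\otimes(\mathbb{C}^d)^{\otimes n}$. Let $\xi^{Ak}:=\mathrm{tr}_{n-k}(\xi^{An})$ be the state on $\mathcal{H}_A\otimes(\mathbb{C}^d)^{\otimes k}$ obtained by tracing out the last $n-k$ factors $\mathbb{C}^d$. A permutation $\pi\in S_n$ acts on $(\mathbb{C}^d)^{\otimes n}$ by permuting the tensor factors. Let $\mathcal{P}^k(\mathcal{H}_A,\mathbb{C}^d)$ be the set of states on $\mathcal{H}_A\otimes(\mathbb{C}^d)^{\otimes k}$ of the form $\int \xi^A_\sigma\otimes\sigma^{\otimes k}\,dm(\sigma)$, where $m$ is a (Borel) probability measure on the set of (mixed) states $\sigma$ on $\mathbb{C}^d$ and $\{\xi^A_\sigma\}_\sigma$ is a (measurable) family of states on $\mathcal{H}_A$. Distances are measured by the trace distance $\|S-T\|:=\tfrac12\mathrm{tr}|S-T|$. (a) If $\xi^{An}$ is permutation-invariant relative to $\mathcal{H}_A$, i.e. $(1_A\otimes\pi)\,\xi^{An}\,(1_A\otimes\pi^\dagger)=\xi^{An}$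 for all $\pi\in S_n$, then there is $\tau\in\mathcal{P}^k(\mathcal{H}_A,\mathbb{C}^d)$ with $\|\xi^{Ak}-\tau\|\le 2\,\frac{d^2k}{n}$. (b) If $\xi^{An}$ is Bose-symmetric relative to $\mathcal{H}_A$, i.e. $(1_A\otimes\pi)\,\xi^{An}=\xi^{An}$ for all $\pi\in S_n$, then there is $\tau\in\mathcal{P}^k(\mathcal{H}_A,\mathbb{C}^d)$ with $\|\xi^{Ak}-\tau\|\le 2\,\frac{dk}{n}$. -/

import Mathlib

open scoped ENNReal InnerProductSpace ComplexOrder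

noncomputable section

namespace DeFinetti

/-! ### Trace, density operators and trace distance on a Hilbert space -/

section Trace

variable {X : Type*} [NormedAddCommGroup X] [InnerProductSpace ℂ X] [CompleteSpace X]

/-- The trace of a positive operator, with values in `[0, ∞]`, computed in a Hilbert basis `b`. -/
def traceIn {ι : Type*} (b : HilbertBasis ι ℂ X) (T : X →L[ℂ] X) : ℝ≥0∞ :=
  ∑' i, ENNReal.ofReal (⟪b i, T (b i)⟫_ℂ).re

variable (X) in
/-- The index set of a Hilbert basis of `X`. -/
def basisIndex : Set X := (exists_hilbertBasis ℂ X).choose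

variable (X) in
/-- A Hilbert basis of `X`. -/
def someBasis : HilbertBasis (basisIndex X) ℂ X := (exists_hilbertBasis ℂ X).choose_spec.choose

/-- The trace `∑ᵢ ⟨bᵢ, T bᵢ⟩ ∈ [0, ∞]` of a positive operator `T`, where `b` is a Hilbert basis. It
does not depend on the basis: see `posTrace_eq_traceIn`. It is only applied to positive operators. -/
def posTrace (T : X →L[ℂ] X) : ℝ≥0∞ := traceIn (someBasis X) T

/-- Density operators (states): positive operators of trace one. -/
structure IsDensityOperator (ρ : X →L[ℂ] X) : Prop where
  isPositive : ρ.IsPositive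
  trace_eq_one : posTrace ρ = 1

/-- The trace distance `‖S - T‖ = (1/2) tr |S - T|`, where `|A| = (A† A)^{1/2}`. -/
def traceDist (S T : X →L[ℂ] X) : ℝ≥0∞ := posTrace (CFC.abs (S - T)) / 2

theorem ofReal_norm_sq_eq_tsum {X : Type*} [NormedAddCommGroup X] [InnerProductSpace ℂ X]
    {ι : Type*} (e : HilbertBasis ι ℂ X) (x : X) :
    ENNReal.ofReal (‖x‖ ^ 2) = ∑' j, ENNReal.ofReal (‖⟪e j, x⟫_ℂ‖ ^ 2) := by
  have h2 : HasSum (fun j => ‖⟪e j, x⟫_ℂ‖ ^ 2) (‖x‖ ^ 2) := by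
    have h3 := Complex.hasSum_re (e.hasSum_inner_mul_inner x x)
    rw [inner_self_eq_norm_sq_to_K] at h3
    convert h3 using 1
    · funext j
      rw [← inner_conj_symm x (e j), ← Complex.normSq_eq_conj_mul_self, Complex.ofReal_re,
        Complex.normSq_eq_norm_sq]
    · norm_cast
  rw [← h2.tsum_eq, ENNReal.ofReal_tsum_of_nonneg (fun _ => by positivity) h2.summable]

theorem traceIn_star_mul_self_comm {ι κ : Type*} (b : HilbertBasis ι ℂ X)
    (c : HilbertBasis κ ℂ X) (A : X →L[ℂ] X) :
    traceIn b (star A * A) = traceIn c (A * star A) := by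
  have diag : ∀ (B : X →L[ℂ] X) (x : X), (⟪x, (star B * B) x⟫_ℂ).re = ‖B x‖ ^ 2 := by
    intro B x
    rw [ContinuousLinearMap.star_eq_adjoint, mul_apply_eq_comp,
      ContinuousLinearMap.adjoint_inner_right, inner_self_eq_norm_sq_to_K]
    norm_cast
  have h1 : traceIn b (star A * A) = ∑' i, ∑' j, ENNReal.ofReal (‖⟪c j, A (b i)⟫_ℂ‖ ^ 2) := by
    unfold traceIn
    refine tsum_congr fun i => ?_
    rw [diag]
    exact ofReal_norm_sq_eq_tsum c (A (b i))
  have h2 : traceIn c (A * star A) =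
      ∑' j, ∑' i, ENNReal.ofReal (‖⟪b i, (star A) (c j)⟫_ℂ‖ ^ 2) := by
    unfold traceIn
    refine tsum_congr fun j => ?_
    have h3 := diag (star A) (c j)
    rw [star_star] at h3
    rw [h3]
    exact ofReal_norm_sq_eq_tsum b ((star A) (c j))
  rw [h1, h2, ENNReal.tsum_comm]
  refine tsum_congr fun j => tsum_congr fun i => ?_
  rw [ContinuousLinearMap.star_eq_adjoint, ContinuousLinearMap.adjoint_inner_right,
    norm_inner_symm]

/-- The trace of a positive operator does not depend on the Hilbert basis. -/
theorem posTrace_eq_traceIn {ι : Type*} (b : HilbertBasis ι ℂ X) {T : X →L[ℂ] X}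
    (hT : T.IsPositive) : posTrace T = traceIn b T := by
  have h0 : 0 ≤ T := (ContinuousLinearMap.nonneg_iff_isPositive T).2 hT
  have hs : star (CFC.sqrt T) = CFC.sqrt T := (CFC.sqrt_nonneg T).isSelfAdjoint
  have h := traceIn_star_mul_self_comm (someBasis X) b (CFC.sqrt T)
  rwa [hs, CFC.sqrt_mul_sqrt_self T h0] at h

end Trace

/-! ### The Hilbert space `H ⊗ (ℂ^d)^{⊗ n}` -/

section System

variable {H : Type*} [NormedAddCommGroup H] [InnerProductSpace ℂ H]

variable (H) in
/-- The Hilbert space `H ⊗ (ℂ^d)^{⊗ n}`. As the second factor is finite-dimensional, with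
orthonormal basis `e_{i₁} ⊗ ⋯ ⊗ e_{iₙ}` indexed by `i : Fin n → Fin d`, each vector is uniquely
`∑ i, x i ⊗ (e_{i₁} ⊗ ⋯ ⊗ e_{iₙ})` with `x i ∈ H`, and its squared norm is `∑ i, ‖x i‖ ^ 2`. -/
abbrev System (d n : ℕ) : Type _ := PiLp 2 (fun _ : Fin n → Fin d => H)

/-- The product vector `a ⊗ w₁ ⊗ ⋯ ⊗ wₙ`. -/
def productVector {d n : ℕ} (a : H) (w : Fin n → EuclideanSpace ℂ (Fin d)) : System H d n :=
  WithLp.toLp 2 fun i => (∏ t, w t (i t)) • a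

/-- The unitary `1 ⊗ π` on `H ⊗ (ℂ^d)^{⊗ n}`, sending `a ⊗ e_{i₁} ⊗ ⋯ ⊗ e_{iₙ}` to
`a ⊗ e_{i_{π⁻¹(1)}} ⊗ ⋯ ⊗ e_{i_{π⁻¹(n)}}`. -/
def permOp {d n : ℕ} (π : Equiv.Perm (Fin n)) : System H d n →L[ℂ] System H d n :=
  ((LinearIsometryEquiv.piLpCongrLeft 2 ℂ H
    (π.arrowCongr (Equiv.refl (Fin d)))).toContinuousLinearEquiv :
      System H d n →L[ℂ] System H d n)

theorem permOp_apply {d n : ℕ} (π : Equiv.Perm (Fin n)) (x : System H d n) (j : Fin n → Fin d) :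
    permOp π x j = x (fun t => j (π t)) := rfl

theorem permOp_productVector {d n : ℕ} (π : Equiv.Perm (Fin n)) (a : H)
    (w : Fin n → EuclideanSpace ℂ (Fin d)) :
    permOp π (productVector a w) = productVector a (fun t => w (π⁻¹ t)) := by
  ext j
  rw [permOp_apply]
  simp only [productVector]
  congr 1
  exact Fintype.prod_equiv π _ _ (fun t => by simp)

/-- The index `(i, l)` of a basis vector of `(ℂ^d)^{⊗ n} = (ℂ^d)^{⊗ k} ⊗ (ℂ^d)^{⊗ (n - k)}`. -/
def joinIndex {d n k : ℕ} (hk : k ≤ n) (i : Fin k → Fin d) (l : Fin (n - k) → Fin d) :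
    Fin n → Fin d :=
  fun t => Fin.append i l (Fin.cast (Nat.add_sub_of_le hk).symm t)

/-- The operator `1 ⊗ ⟨e_l| : H ⊗ (ℂ^d)^{⊗ k} ⊗ (ℂ^d)^{⊗ (n - k)} → H ⊗ (ℂ^d)^{⊗ k}`. -/
def contractLast {d n k : ℕ} (hk : k ≤ n) (l : Fin (n - k) → Fin d) :
    System H d n →L[ℂ] System H d k :=
  ((PiLp.continuousLinearEquiv 2 ℂ (fun _ : Fin k → Fin d => H)).symm :
      ((Fin k → Fin d) → H) →L[ℂ] System H d k) ∘L
    ContinuousLinearMap.pi fun i =>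
      PiLp.proj 2 (fun _ : Fin n → Fin d => H) (joinIndex hk i l)

theorem contractLast_apply {d n k : ℕ} (hk : k ≤ n) (l : Fin (n - k) → Fin d)
    (x : System H d n) (i : Fin k → Fin d) :
    contractLast hk l x i = x (joinIndex hk i l) := rfl

/-- The partial trace `tr_{n-k}` over the last `n - k` tensor factors,
`ξ ↦ ∑ l, (1 ⊗ ⟨e_l|) ξ (1 ⊗ |e_l⟩)`. -/
def partialTrace [CompleteSpace H] {d n k : ℕ} (hk : k ≤ n)
    (ξ : System H d n →L[ℂ] System H d n) : System H d k →L[ℂ] System H d k :=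
  ∑ l : Fin (n - k) → Fin d,
    contractLast hk l ∘L ξ ∘L ContinuousLinearMap.adjoint (contractLast hk l)

/-- `ξ` is permutation-invariant relative to `H`: `(1 ⊗ π) ξ (1 ⊗ π†) = ξ` for all `π`. -/
def IsSymmetricRel [CompleteSpace H] {d n : ℕ} (ξ : System H d n →L[ℂ] System H d n) : Prop :=
  ∀ π : Equiv.Perm (Fin n),
    permOp π ∘L ξ ∘L ContinuousLinearMap.adjoint (permOp π) = ξ

/-- `ξ` is Bose-symmetric relative to `H`: `(1 ⊗ π) ξ = ξ` for all `π`. -/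
def IsBoseSymmetricRel {d n : ℕ} (ξ : System H d n →L[ℂ] System H d n) : Prop :=
  ∀ π : Equiv.Perm (Fin n), permOp π ∘L ξ = ξ

/-! ### Mixtures of product states -/

/-- The (mixed) states on `ℂ^d`: positive semidefinite `d × d` matrices of trace one. -/
def DensityMatrix (d : ℕ) : Type :=
  {σ : Matrix (Fin d) (Fin d) ℂ // σ.PosSemidef ∧ σ.trace = 1}

instance (d : ℕ) : TopologicalSpace (DensityMatrix d) :=
  inferInstanceAs (TopologicalSpace {σ : Matrix (Fin d) (Fin d) ℂ // σ.PosSemidef ∧ σ.trace = 1})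

instance (d : ℕ) : MeasurableSpace (DensityMatrix d) := borel _

instance (d : ℕ) : BorelSpace (DensityMatrix d) := ⟨rfl⟩

/-- The operator `A ⊗ σ^{⊗ k}` on `H ⊗ (ℂ^d)^{⊗ k}`, whose block at `(i, j)` is
`(∏ t, σ (i t) (j t)) • A`. -/
def tensorPower {d : ℕ} (k : ℕ) (A : H →L[ℂ] H) (σ : Matrix (Fin d) (Fin d) ℂ) :
    System H d k →L[ℂ] System H d k :=
  ((PiLp.continuousLinearEquiv 2 ℂ (fun _ : Fin k → Fin d => H)).symm :
      ((Fin k → Fin d) → H) →L[ℂ] System H d k) ∘L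
    ContinuousLinearMap.pi fun i =>
      ∑ j : Fin k → Fin d, (∏ t, σ (i t) (j t)) •
        (A ∘L PiLp.proj 2 (fun _ : Fin k → Fin d => H) j)

theorem tensorPower_apply {d : ℕ} (k : ℕ) (A : H →L[ℂ] H) (σ : Matrix (Fin d) (Fin d) ℂ)
    (x : System H d k) (i : Fin k → Fin d) :
    tensorPower k A σ x i = ∑ j : Fin k → Fin d, (∏ t, σ (i t) (j t)) • A (x j) := by
  simp [tensorPower]

theorem tensorPower_productVector {d : ℕ} (k : ℕ) (A : H →L[ℂ] H)
    (σ : Matrix (Fin d) (Fin d) ℂ) (a : H) (w : Fin k → EuclideanSpace ℂ (Fin d)) :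
    tensorPower k A σ (productVector a w) =
      productVector (A a) (fun t => Matrix.toEuclideanLin σ (w t)) := by
  ext i
  rw [tensorPower_apply]
  simp only [productVector, map_smul, smul_smul, ← Finset.sum_smul, ← Finset.prod_mul_distrib]
  congr 1
  simp only [Matrix.ofLp_toLpLin, Matrix.toLin'_apply, Matrix.mulVec, dotProduct]
  rw [Finset.prod_univ_sum, Fintype.piFinset_univ]

variable (H) in
/-- The set `𝒫^k(H, ℂ^d)` of the states of the form `∫ ξ_σ ⊗ σ^{⊗ k} dm(σ)`, where `m` is a
probability measure on the states on `ℂ^d` and `ξ_σ` is a (measurable) family of states on `H`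
parameterised by the states `σ` on `ℂ^d`. The integral is the Bochner integral; the integrand is
bounded and strongly measurable, hence integrable. -/
def productMixtures [CompleteSpace H] (d k : ℕ) : Set (System H d k →L[ℂ] System H d k) :=
  {τ | IsDensityOperator τ ∧
    ∃ (m : MeasureTheory.Measure (DensityMatrix d)) (ξ : DensityMatrix d → (H →L[ℂ] H)),
      MeasureTheory.IsProbabilityMeasure m ∧
      MeasureTheory.StronglyMeasurable ξ ∧
      (∀ σ, IsDensityOperator (ξ σ)) ∧
      τ = ∫ σ, tensorPower k (ξ σ) σ.1 ∂m}

end System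

end DeFinetti

end

open scoped ENNReal InnerProductSpace ComplexOrder

noncomputable section

namespace DeFinetti

/-! ### Traces of positive operators and of their differences -/

section Trace

variable {X : Type*} [NormedAddCommGroup X] [InnerProductSpace ℂ X] [CompleteSpace X]

/-! Bose-symmetric case, with `D` the one-particle dimension. Let Π_m be the projection onto the
symmetric subspace of (ℂ^D)^{⊗m}. `exists_design` yields finitely many unit vectors φ_s and weights
w_s ≥ 0 with ∑ w_s |φ_s^{⊗n}⟩⟨φ_s^{⊗n}| = Π_n. Tracing out k factors turns this into ∑ w_s
|φ_s^{⊗(n-k)}⟩⟨φ_s^{⊗(n-k)}| = c Π_{n-k}, where 1 - 1/c ≤ (D - 1)k/n (`design_marginal`).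

Measure all n factors of the state T = Π_n T in this way: outcome s leaves A_s on H, and the
candidate is τ = ∑ A_s ⊗ |φ_s⟩⟨φ_s|^{⊗k}. Measure instead only the last n - k factors, leaving Y_s
on H ⊗ (ℂ^D)^{⊗k}, and let p_s be the projection onto φ_s^{⊗k}. With K the reduced state, ∑ Y_s =
cK, ∑ p_s Y_s = ∑ Y_s p_s = K and ∑ p_s Y_s p_s = τ. Hence (1/c) ∑ (1 - p_s) Y_s (1 - p_s) = K -
(2/c)K + (1/c)τ is positive of trace 1 - 1/c, and K - τ is a difference of positive operators of
total trace at most 4(1 - 1/c) (`exists_mixture_sub`). Half of this is at most 2Dk/n.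

Permutation-invariant case: √ξ is invariant too. Reading its column index in (ℂ^d)^{⊗n} as a second
copy of that space gives a Bose-symmetric extension with D = d² (`exists_bose_extension`). Tracing
out the second copies preserves the bound and turns each φ_s into a mixed state. Since the design is
finite, the mixing measure is a finite sum of Dirac masses (`mem_productMixtures_of_finite`). -/

theorem posTrace_add {S T : X →L[ℂ] X} (hS : S.IsPositive) (hT : T.IsPositive) :
    posTrace (S + T) = posTrace S + posTrace T := by
  unfold posTrace traceIn
  rw [← ENNReal.tsum_add]
  refine tsum_congr fun i => ?_
  have hSi : 0 ≤ (⟪someBasis X i, S (someBasis X i)⟫_ℂ).re := hS.re_inner_nonneg_right _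
  have hTi : 0 ≤ (⟪someBasis X i, T (someBasis X i)⟫_ℂ).re := hT.re_inner_nonneg_right _
  rw [← ENNReal.ofReal_add hSi hTi]
  simp

theorem posTrace_zero : posTrace (0 : X →L[ℂ] X) = 0 := by
  simp [posTrace, traceIn]

theorem posTrace_sum {ι : Type*} (s : Finset ι) (T : ι → X →L[ℂ] X)
    (hT : ∀ i ∈ s, (T i).IsPositive) : posTrace (∑ i ∈ s, T i) = ∑ i ∈ s, posTrace (T i) := by
  classical
  induction s using Finset.induction_on with
  | empty => simp [posTrace_zero]
  | insert a s ha ih =>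
    rw [Finset.sum_insert ha, Finset.sum_insert ha, posTrace_add (hT a (by simp)), ih]
    · exact fun i hi => hT i (by simp [hi])
    · exact ContinuousLinearMap.isPositive_sum s fun i hi => hT i (by simp [hi])

theorem posTrace_smul {c : ℝ} (hc : 0 ≤ c) (T : X →L[ℂ] X) :
    posTrace ((c : ℂ) • T) = ENNReal.ofReal c * posTrace T := by
  unfold posTrace traceIn
  rw [← ENNReal.tsum_mul_left]
  refine tsum_congr fun i => ?_
  rw [← ENNReal.ofReal_mul hc]
  simp

omit [CompleteSpace X] in
theorem isPositive_ofReal_smul {c : ℝ} (hc : 0 ≤ c) {T : X →L[ℂ] X} (hT : T.IsPositive) :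
    ((c : ℂ) • T).IsPositive :=
  hT.smul_of_nonneg (by exact_mod_cast hc)

/-- A Hilbert basis each of whose vectors lies in `K` or in its orthogonal complement. -/
theorem exists_hilbertBasis_adapted (K : Submodule ℂ X) (hK : IsClosed (K : Set X)) :
    ∃ (w : Set X) (b : HilbertBasis w ℂ X), ∀ i, b i ∈ K ∨ b i ∈ Kᗮ := by
  have : CompleteSpace K := hK.completeSpace_coe
  obtain ⟨s, c, hc⟩ := exists_hilbertBasis ℂ K
  have hon : Orthonormal ℂ (fun x : s => ((c x : K) : X)) := by
    have := c.orthonormal.comp_linearIsometry K.subtypeₗᵢ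
    exact this
  have hon' : Orthonormal ℂ ((↑) : Set.range (fun x : s => ((c x : K) : X)) → X) :=
    hon.toSubtypeRange
  obtain ⟨w, b, hw, hb⟩ := hon'.exists_hilbertBasis_extension
  refine ⟨w, b, fun i => ?_⟩
  by_cases hi : (i : X) ∈ Set.range (fun x : s => ((c x : K) : X))
  · left
    obtain ⟨x, hx⟩ := hi
    rw [hb, ← hx]
    exact (c x).2
  · right
    rw [Submodule.mem_orthogonal]
    intro u hu
    have key : ∀ y : K, ⟪(y : X), b i⟫_ℂ = 0 := by
      have h0 : ∀ x : s, ⟪((c x : K) : X), b i⟫_ℂ = 0 := by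
        intro x
        have hx : ((c x : K) : X) ∈ w := hw ⟨x, rfl⟩
        have h1 : ((c x : K) : X) = b ⟨_, hx⟩ := by rw [hb]
        rw [h1]
        refine b.orthonormal.2 ?_
        intro h
        apply hi
        rw [← h]
        exact ⟨x, rfl⟩
      intro y
      have hd := c.dense_span
      have hcl : IsClosed {y : K | ⟪(y : X), b i⟫_ℂ = 0} :=
        isClosed_eq (by fun_prop) continuous_const
      have hsub : ((Submodule.span ℂ (Set.range c) : Submodule ℂ K) : Set K) ⊆
          {y : K | ⟪(y : X), b i⟫_ℂ = 0} := by
        intro z hz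
        induction hz using Submodule.span_induction with
        | mem x hx => obtain ⟨t, rfl⟩ := hx; exact h0 t
        | zero => simp
        | add x y _ _ hx hy =>
          simp only [Set.mem_ofPred_eq] at hx hy ⊢
          simp [hx, hy]
        | smul a x _ hx =>
          simp only [Set.mem_ofPred_eq] at hx ⊢
          simp [hx]
      have : y ∈ ((Submodule.span ℂ (Set.range c)).topologicalClosure : Submodule ℂ K) := by
        rw [hd]; trivial
      exact closure_minimal hsub hcl this
    exact key ⟨u, hu⟩

/-- The trace norm of a difference of positive operators is at most the sum of the traces. -/
theorem posTrace_abs_sub_le {P Q : X →L[ℂ] X} (hP : P.IsPositive) (hQ : Q.IsPositive) :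
    posTrace (CFC.abs (P - Q)) ≤ posTrace P + posTrace Q := by
  set D := P - Q with hD
  have hsa : IsSelfAdjoint D := hP.isSelfAdjoint.sub hQ.isSelfAdjoint
  have hpos : D⁺.IsPositive :=
    (ContinuousLinearMap.nonneg_iff_isPositive _).1 (CFC.posPart_nonneg D)
  have hneg : D⁻.IsPositive :=
    (ContinuousLinearMap.nonneg_iff_isPositive _).1 (CFC.negPart_nonneg D)
  have hsub : D⁺ - D⁻ = D := CFC.posPart_sub_negPart D hsa
  have hmul : D⁻ * D⁺ = 0 := CFC.negPart_mul_posPart D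
  have habs : CFC.abs D = D⁺ + D⁻ := (CFC.posPart_add_negPart D hsa).symm
  have hker : ∀ x, D⁻ (D⁺ x) = 0 := fun x => by
    rw [← mul_apply_eq_comp, hmul]
    rfl
  -- In this basis the bound holds term by term: `D⁻` vanishes on the kernel vectors, and the others
  -- are orthogonal to the range of `D⁺`, which lies in the kernel. So each diagonal entry of |D| is
  -- plus or minus that of `P - Q`.
  obtain ⟨w, b, hb⟩ := exists_hilbertBasis_adapted (LinearMap.ker (D⁻ : X →L[ℂ] X).toLinearMap)
    (D⁻ : X →L[ℂ] X).isClosed_ker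
  have habsp : (CFC.abs D).IsPositive := by rw [habs]; exact hpos.add hneg
  rw [posTrace_eq_traceIn b habsp, posTrace_eq_traceIn b hP, posTrace_eq_traceIn b hQ]
  unfold traceIn
  rw [← ENNReal.tsum_add]
  refine ENNReal.tsum_le_tsum fun i => ?_
  have hPi : 0 ≤ (⟪b i, P (b i)⟫_ℂ).re := hP.re_inner_nonneg_right (b i)
  have hQi : 0 ≤ (⟪b i, Q (b i)⟫_ℂ).re := hQ.re_inner_nonneg_right (b i)
  rw [← ENNReal.ofReal_add hPi hQi]
  apply ENNReal.ofReal_le_ofReal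
  have e1 : (⟪b i, D⁺ (b i)⟫_ℂ).re - (⟪b i, D⁻ (b i)⟫_ℂ).re =
      (⟪b i, P (b i)⟫_ℂ).re - (⟪b i, Q (b i)⟫_ℂ).re := by
    have : (⟪b i, (D⁺ - D⁻) (b i)⟫_ℂ).re = (⟪b i, (P - Q) (b i)⟫_ℂ).re := by rw [hsub]
    simpa [inner_sub_right] using this
  have e2 : (⟪b i, (CFC.abs D) (b i)⟫_ℂ).re =
      (⟪b i, D⁺ (b i)⟫_ℂ).re + (⟪b i, D⁻ (b i)⟫_ℂ).re := by
    rw [habs]; simp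
  rw [e2]
  rcases hb i with h | h
  · have : (D⁻) (b i) = 0 := h
    rw [this] at e1 ⊢
    simp only [inner_zero_right, Complex.zero_re] at e1 ⊢
    linarith
  · have : ⟪b i, D⁺ (b i)⟫_ℂ = 0 := by
      rw [← inner_conj_symm, Submodule.mem_orthogonal _ _ |>.1 h _ (hker (b i)), map_zero]
    rw [this] at e1 ⊢
    simp only [Complex.zero_re] at e1 ⊢
    linarith

end Trace

/-! ### Operators on H ⊗ ℂ^ι as matrices of operators on H -/

section Blocks

variable {H : Type*} [NormedAddCommGroup H] [InnerProductSpace ℂ H] [CompleteSpace H]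
variable {ι κ μ : Type*} [Fintype ι] [Fintype κ] [Fintype μ]

variable (H) in
/-- The coordinate `1 ⊗ ⟨e_i|` on `H ⊗ ℂ^ι`. -/
abbrev coord (i : ι) : PiLp 2 (fun _ : ι => H) →L[ℂ] H := PiLp.proj 2 (fun _ : ι => H) i

theorem adjoint_coord_apply [DecidableEq ι] (i : ι) (h : H) :
    ContinuousLinearMap.adjoint (coord H i) h = PiLp.single 2 i h := by
  refine ext_inner_right ℂ fun y => ?_
  rw [ContinuousLinearMap.adjoint_inner_left, PiLp.inner_apply,
    Finset.sum_eq_single i]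
  · simp
  · intro j _ hj
    simp [hj]
  · simp

/-- The block `(1 ⊗ ⟨e_i|) T (1 ⊗ |e_j⟩)` of an operator on `H ⊗ ℂ^ι`. -/
def block (T : PiLp 2 (fun _ : ι => H) →L[ℂ] PiLp 2 (fun _ : ι => H)) (i j : ι) : H →L[ℂ] H :=
  coord H i ∘L T ∘L ContinuousLinearMap.adjoint (coord H j)

theorem sum_adjoint_coord (x : PiLp 2 (fun _ : ι => H)) :
    ∑ i, ContinuousLinearMap.adjoint (coord H i) (x i) = x := by
  classical
  ext j
  simp only [adjoint_coord_apply, WithLp.ofLp_sum, Finset.sum_apply]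
  rw [Finset.sum_eq_single j]
  · simp
  · intro i _ hi
    simp [hi.symm]
  · simp

theorem apply_eq_sum_block (T : PiLp 2 (fun _ : ι => H) →L[ℂ] PiLp 2 (fun _ : ι => H))
    (x : PiLp 2 (fun _ : ι => H)) (i : ι) : T x i = ∑ j, block T i j (x j) := by
  conv_lhs => rw [← sum_adjoint_coord x, map_sum]
  simp [block]

theorem ext_block {S T : PiLp 2 (fun _ : ι => H) →L[ℂ] PiLp 2 (fun _ : ι => H)}
    (h : ∀ i j, block S i j = block T i j) : S = T := by
  ext x i
  rw [apply_eq_sum_block, apply_eq_sum_block]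
  simp [h]

theorem block_sub (S T : PiLp 2 (fun _ : ι => H) →L[ℂ] PiLp 2 (fun _ : ι => H)) (i j : ι) :
    block (S - T) i j = block S i j - block T i j := by
  ext; simp [block]

theorem block_smul (c : ℂ) (T : PiLp 2 (fun _ : ι => H) →L[ℂ] PiLp 2 (fun _ : ι => H)) (i j : ι) :
    block (c • T) i j = c • block T i j := by
  ext; simp [block]

theorem block_sum {σ : Type*} (s : Finset σ)
    (T : σ → PiLp 2 (fun _ : ι => H) →L[ℂ] PiLp 2 (fun _ : ι => H)) (i j : ι) :
    block (∑ a ∈ s, T a) i j = ∑ a ∈ s, block (T a) i j := by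
  ext; simp [block]

theorem block_adjoint (T : PiLp 2 (fun _ : ι => H) →L[ℂ] PiLp 2 (fun _ : ι => H)) (i j : ι) :
    block (ContinuousLinearMap.adjoint T) i j = ContinuousLinearMap.adjoint (block T j i) := by
  simp [block, ContinuousLinearMap.adjoint_comp, ContinuousLinearMap.comp_assoc]

theorem block_comp (S T : PiLp 2 (fun _ : ι => H) →L[ℂ] PiLp 2 (fun _ : ι => H)) (i j : ι) :
    block (S ∘L T) i j = ∑ a, block S i a ∘L block T a j := by
  ext x
  have := apply_eq_sum_block S (T (ContinuousLinearMap.adjoint (coord H j) x)) i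
  simpa [block] using this

theorem isPositive_block {T : PiLp 2 (fun _ : ι => H) →L[ℂ] PiLp 2 (fun _ : ι => H)}
    (hT : T.IsPositive) (i : ι) : (block T i i).IsPositive :=
  hT.conj_adjoint (coord H i)

/-- The Hilbert basis `b_α ⊗ e_i` of `H ⊗ ℂ^ι`. -/
theorem exists_hilbertBasis_prod {α : Type*} (b : HilbertBasis α ℂ H) :
    ∃ c : HilbertBasis (ι × α) ℂ (PiLp 2 (fun _ : ι => H)),
      ∀ p, c p = ContinuousLinearMap.adjoint (coord H p.1) (b p.2) := by
  classical
  have hon : Orthonormal ℂ (fun p : ι × α =>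
      ContinuousLinearMap.adjoint (coord H p.1) (b p.2)) := by
    rw [orthonormal_iff_ite]
    rintro ⟨i, a⟩ ⟨j, a'⟩
    rw [ContinuousLinearMap.adjoint_inner_left, adjoint_coord_apply]
    by_cases hij : i = j
    · subst hij
      simp [orthonormal_iff_ite.1 b.orthonormal]
    · simp [hij]
  refine ⟨HilbertBasis.mkOfOrthogonalEqBot hon ?_, fun p => congrFun (HilbertBasis.coe_mkOfOrthogonalEqBot hon _) p⟩
  rw [Submodule.eq_bot_iff]
  intro x hx
  rw [Submodule.mem_orthogonal] at hx
  ext i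
  have h1 : ∀ a, ⟪b a, x i⟫_ℂ = 0 := by
    intro a
    have := hx _ (Submodule.subset_span ⟨(i, a), rfl⟩)
    rwa [ContinuousLinearMap.adjoint_inner_left] at this
  have h2 : b.repr (x i) = 0 := by
    ext a
    rw [b.repr_apply_apply, h1]; rfl
  simpa using h2

theorem posTrace_eq_sum_block {T : PiLp 2 (fun _ : ι => H) →L[ℂ] PiLp 2 (fun _ : ι => H)}
    (hT : T.IsPositive) : posTrace T = ∑ i, posTrace (block T i i) := by
  obtain ⟨c, hc⟩ := exists_hilbertBasis_prod (ι := ι) (someBasis H)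
  rw [posTrace_eq_traceIn c hT]
  unfold posTrace traceIn
  rw [ENNReal.tsum_prod', tsum_fintype]
  refine Finset.sum_congr rfl fun i _ => tsum_congr fun a => ?_
  rw [hc, ContinuousLinearMap.adjoint_inner_left]
  rfl

variable (H) in
/-- The operator `1 ⊗ ⟨e_l|` from `H ⊗ ℂ^κ ⊗ ℂ^μ`, with basis indexed through `e`, to
`H ⊗ ℂ^κ`. -/
def restrictAt (e : κ → μ → ι) (l : μ) :
    PiLp 2 (fun _ : ι => H) →L[ℂ] PiLp 2 (fun _ : κ => H) :=
  ((PiLp.continuousLinearEquiv 2 ℂ (fun _ : κ => H)).symm :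
      (κ → H) →L[ℂ] PiLp 2 (fun _ : κ => H)) ∘L
    ContinuousLinearMap.pi fun i => PiLp.proj 2 (fun _ : ι => H) (e i l)

omit [CompleteSpace H] [Fintype ι] [Fintype κ] [Fintype μ] in
theorem coord_comp_restrictAt (e : κ → μ → ι) (i : κ) (l : μ) :
    coord H i ∘L restrictAt H e l = coord H (e i l) := rfl

/-- The partial trace over `ℂ^μ` on `H ⊗ ℂ^κ ⊗ ℂ^μ`, with basis indexed through `e`. -/
def partialTraceAlong (e : κ → μ → ι)
    (T : PiLp 2 (fun _ : ι => H) →L[ℂ] PiLp 2 (fun _ : ι => H)) :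
    PiLp 2 (fun _ : κ => H) →L[ℂ] PiLp 2 (fun _ : κ => H) :=
  ∑ l, restrictAt H e l ∘L T ∘L ContinuousLinearMap.adjoint (restrictAt H e l)

theorem block_partialTraceAlong (e : κ → μ → ι)
    (T : PiLp 2 (fun _ : ι => H) →L[ℂ] PiLp 2 (fun _ : ι => H)) (i j : κ) :
    block (partialTraceAlong e T) i j = ∑ l, block T (e i l) (e j l) := by
  rw [partialTraceAlong, block_sum]
  refine Finset.sum_congr rfl fun l _ => ?_
  simp only [block]
  rw [← coord_comp_restrictAt e i l, ← coord_comp_restrictAt e j l,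
    ContinuousLinearMap.adjoint_comp]
  rfl

theorem isPositive_partialTraceAlong (e : κ → μ → ι)
    {T : PiLp 2 (fun _ : ι => H) →L[ℂ] PiLp 2 (fun _ : ι => H)} (hT : T.IsPositive) :
    (partialTraceAlong e T).IsPositive :=
  ContinuousLinearMap.isPositive_sum _ fun l _ => hT.conj_adjoint (restrictAt H e l)

theorem posTrace_partialTraceAlong {e : κ → μ → ι} (he : Function.Bijective (Function.uncurry e))
    {T : PiLp 2 (fun _ : ι => H) →L[ℂ] PiLp 2 (fun _ : ι => H)} (hT : T.IsPositive) :
    posTrace (partialTraceAlong e T) = posTrace T := by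
  rw [posTrace_eq_sum_block hT, posTrace_eq_sum_block (isPositive_partialTraceAlong e hT),
    ← he.sum_comp, Fintype.sum_prod_type]
  refine Finset.sum_congr rfl fun i _ => ?_
  rw [block_partialTraceAlong, posTrace_sum _ _ fun l _ => isPositive_block hT _]
  rfl

end Blocks

/-! ### The measured state and its distance from the reduced state -/

section Mixture

variable {H : Type*} [NormedAddCommGroup H] [InnerProductSpace ℂ H] [CompleteSpace H]
variable {ι κ μ : Type*} [Fintype ι] [Fintype κ] [Fintype μ]

variable (H) in
/-- The operator `1 ⊗ ⟨v|` from `H ⊗ ℂ^ι` to `H`. -/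
def bra (v : ι → ℂ) : PiLp 2 (fun _ : ι => H) →L[ℂ] H := ∑ i, star (v i) • coord H i

variable (H) in
/-- The operator `1 ⊗ ⟨v|` from `H ⊗ ℂ^κ ⊗ ℂ^μ` to `H ⊗ ℂ^κ`. -/
def braAt (e : κ → μ → ι) (v : μ → ℂ) :
    PiLp 2 (fun _ : ι => H) →L[ℂ] PiLp 2 (fun _ : κ => H) := ∑ l, star (v l) • restrictAt H e l

theorem adjoint_bra (v : ι → ℂ) : ContinuousLinearMap.adjoint (bra H v) =
    ∑ i, v i • ContinuousLinearMap.adjoint (coord H i) := by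
  simp [bra, map_sum, map_smulₛₗ]

theorem coord_comp_adjoint_coord [DecidableEq ι] (i j : ι) :
    coord H i ∘L ContinuousLinearMap.adjoint (coord H j) = if i = j then 1 else 0 := by
  ext x
  simp only [ContinuousLinearMap.comp_apply, adjoint_coord_apply]
  by_cases h : i = j
  · subst h; simp
  · simp [h]

theorem coord_comp_adjoint_bra (v : ι → ℂ) (i : ι) :
    coord H i ∘L ContinuousLinearMap.adjoint (bra H v) = v i • 1 := by
  classical
  simp [adjoint_bra, ContinuousLinearMap.comp_finsetSum, coord_comp_adjoint_coord,
    Finset.sum_ite_eq]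

theorem bra_comp_adjoint_coord (v : ι → ℂ) (i : ι) :
    bra H v ∘L ContinuousLinearMap.adjoint (coord H i) = star (v i) • 1 := by
  classical
  simp [bra, ContinuousLinearMap.finsetSum_comp, coord_comp_adjoint_coord, Finset.sum_ite_eq']

omit [CompleteSpace H] [Fintype ι] in
theorem coord_comp_braAt (e : κ → μ → ι) (v : μ → ℂ) (i : κ) :
    coord H i ∘L braAt H e v = ∑ l, star (v l) • coord H (e i l) := by
  simp [braAt, ContinuousLinearMap.comp_finsetSum, coord_comp_restrictAt]

theorem block_bra_bra (v : ι → ℂ) (B : H →L[ℂ] H) (i j : ι) :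
    block (ContinuousLinearMap.adjoint (bra H v) ∘L B ∘L bra H v) i j =
      (v i * star (v j)) • B := by
  have h1 := coord_comp_adjoint_bra (H := H) v i
  have h2 := bra_comp_adjoint_coord (H := H) v j
  have : block (ContinuousLinearMap.adjoint (bra H v) ∘L B ∘L bra H v) i j =
      (coord H i ∘L ContinuousLinearMap.adjoint (bra H v)) ∘L B ∘L
        (bra H v ∘L ContinuousLinearMap.adjoint (coord H j)) := rfl
  rw [this, h1, h2]
  ext x
  simp [smul_smul, mul_comm]

theorem block_braAt (e : κ → μ → ι) (v : μ → ℂ)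
    (T : PiLp 2 (fun _ : ι => H) →L[ℂ] PiLp 2 (fun _ : ι => H)) (i j : κ) :
    block (braAt H e v ∘L T ∘L ContinuousLinearMap.adjoint (braAt H e v)) i j =
      ∑ l', ∑ l, (star (v l) * v l') • block T (e i l) (e j l') := by
  have : block (braAt H e v ∘L T ∘L ContinuousLinearMap.adjoint (braAt H e v)) i j =
      (coord H i ∘L braAt H e v) ∘L T ∘L
        ContinuousLinearMap.adjoint (coord H j ∘L braAt H e v) := by
    rw [ContinuousLinearMap.adjoint_comp]; rfl
  rw [this, coord_comp_braAt, coord_comp_braAt]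
  ext x
  simp only [block, map_sum, map_smulₛₗ, Finset.smul_sum, smul_smul, ContinuousLinearMap.comp_apply,
    _root_.sum_apply, _root_.smul_apply, starRingEnd_apply, star_star]
  refine Finset.sum_congr rfl fun l' _ => Finset.sum_congr rfl fun l _ => ?_
  simp [mul_comm]

theorem bra_conj (v : ι → ℂ) (T : PiLp 2 (fun _ : ι => H) →L[ℂ] PiLp 2 (fun _ : ι => H)) :
    bra H v ∘L T ∘L ContinuousLinearMap.adjoint (bra H v) =
      ∑ j, ∑ i, (star (v i) * v j) • block T i j := by
  rw [adjoint_bra]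
  ext x
  simp [bra, block, map_sum, Finset.smul_sum, smul_smul]
  simp only [mul_comm]

omit [CompleteSpace H] in
theorem bra_comp_braAt (e : κ → μ → ι) (he : Function.Bijective (Function.uncurry e))
    (u : κ → ℂ) (v : μ → ℂ) (Ψ : ι → ℂ) (hΨ : ∀ i l, Ψ (e i l) = u i * v l) :
    bra H u ∘L braAt H e v = bra H Ψ := by
  have h : ∀ i, coord H i ∘L braAt H e v = ∑ l, star (v l) • coord H (e i l) :=
    coord_comp_braAt e v
  rw [bra, ContinuousLinearMap.finsetSum_comp, bra, ← he.sum_comp, Fintype.sum_prod_type]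
  refine Finset.sum_congr rfl fun i _ => ?_
  rw [ContinuousLinearMap.smul_comp, h, Finset.smul_sum]
  refine Finset.sum_congr rfl fun l _ => ?_
  rw [Function.uncurry_apply_pair, hΨ, smul_smul, star_mul']

/-- Since Ω = (1 - 2r)K + rτ, one has K - τ = 2(1 - r)K - (Ω + (1 - r)τ). The hypothesis is written
without subtraction, so that traces in [0, ∞] can be taken and cancelled; this gives tr Ω = 1 - r.
-/
theorem exists_sub_of_residue {X : Type*} [NormedAddCommGroup X] [InnerProductSpace ℂ X]
    [CompleteSpace X] {K τ Ω : X →L[ℂ] X} (hK : IsDensityOperator K) (hτ : IsDensityOperator τ)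
    (hΩ : Ω.IsPositive) {r : ℝ} (hr0 : 0 ≤ r) (hr1 : r ≤ 1)
    (h : Ω + (r : ℂ) • K + (r : ℂ) • K = K + (r : ℂ) • τ) :
    ∃ P Q : X →L[ℂ] X, P.IsPositive ∧ Q.IsPositive ∧ K - τ = P - Q ∧
      posTrace P + posTrace Q ≤ ENNReal.ofReal (4 * (1 - r)) := by
  have hrK : ((r : ℂ) • K).IsPositive := isPositive_ofReal_smul hr0 hK.isPositive
  have h1r : 0 ≤ 1 - r := by linarith
  have hrτ : (((1 - r : ℝ) : ℂ) • τ).IsPositive := isPositive_ofReal_smul h1r hτ.isPositive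
  have hΩtr : posTrace Ω = ENNReal.ofReal (1 - r) := by
    have h5 := congrArg posTrace h
    rw [posTrace_add (hΩ.add hrK) hrK, posTrace_add hΩ hrK,
      posTrace_add hK.isPositive (isPositive_ofReal_smul hr0 hτ.isPositive),
      posTrace_smul hr0 K, posTrace_smul hr0 τ, hK.trace_eq_one, hτ.trace_eq_one, mul_one] at h5
    have h6 := (ENNReal.add_left_inj (by simp)).1 h5
    have h7 : posTrace Ω + ENNReal.ofReal r = ENNReal.ofReal (1 - r) + ENNReal.ofReal r := by
      rw [h6, ← ENNReal.ofReal_add h1r hr0]; simp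
    exact (ENNReal.add_left_inj (by simp)).1 h7
  refine ⟨((2 * (1 - r) : ℝ) : ℂ) • K, Ω + ((1 - r : ℝ) : ℂ) • τ,
    isPositive_ofReal_smul (by linarith) hK.isPositive, hΩ.add hrτ, ?_, ?_⟩
  · have h8 : Ω = K + (r : ℂ) • τ - (r : ℂ) • K - (r : ℂ) • K := by
      rw [← h]; abel
    rw [h8]
    push_cast
    module
  · rw [posTrace_add hΩ hrτ, posTrace_smul h1r, posTrace_smul (by linarith), hΩtr,
      hK.trace_eq_one, hτ.trace_eq_one, mul_one, mul_one, ← ENNReal.ofReal_add h1r h1r,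
      ← ENNReal.ofReal_add (by linarith) (by linarith)]
    exact (congrArg ENNReal.ofReal (by ring)).le

/-- Here Ψ_s = u_s ⊗ v_s. Hypothesis `h1` says that ∑ w_s |Ψ_s⟩⟨Ψ_s| fixes `T`, and `h2` that ∑ w_s
|v_s⟩⟨v_s| on the second factor multiplies `T` by `c`. The residue (1/c) ∑ (1 - p_s) Y_s (1 - p_s)
is expanded using these two facts. -/
theorem exists_mixture_sub {e : κ → μ → ι} (he : Function.Bijective (Function.uncurry e))
    {S : Type*} [Fintype S] {w : S → ℝ} (hw : ∀ s, 0 ≤ w s) {u : S → κ → ℂ} {v : S → μ → ℂ}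
    {Ψ : S → ι → ℂ} (hΨ : ∀ s i l, Ψ s (e i l) = u s i * v s l)
    (hu : ∀ s, ∑ i, u s i * star (u s i) = 1) {c : ℝ} (hc : 1 ≤ c)
    {T : PiLp 2 (fun _ : ι => H) →L[ℂ] PiLp 2 (fun _ : ι => H)} (hT : IsDensityOperator T)
    (h1 : ∀ a b, ∑ s, ∑ a', ((w s : ℂ) * (Ψ s a * star (Ψ s a'))) • block T a' b = block T a b)
    (h2 : ∀ i l b, ∑ s, ∑ l', ((w s : ℂ) * (v s l * star (v s l'))) • block T (e i l') b =
      (c : ℂ) • block T (e i l) b) :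
    ∃ (A : S → H →L[ℂ] H) (τ P Q : PiLp 2 (fun _ : κ => H) →L[ℂ] PiLp 2 (fun _ : κ => H)),
      (∀ s, (A s).IsPositive) ∧ ∑ s, posTrace (A s) = 1 ∧ IsDensityOperator τ ∧
      (∀ i j, block τ i j = ∑ s, (u s i * star (u s j)) • A s) ∧
      P.IsPositive ∧ Q.IsPositive ∧ partialTraceAlong e T - τ = P - Q ∧
      posTrace P + posTrace Q ≤ ENNReal.ofReal (4 * (1 - 1 / c)) := by
  set B : S → H →L[ℂ] H := fun s => bra H (Ψ s) ∘L T ∘L ContinuousLinearMap.adjoint (bra H (Ψ s))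
    with hB
  have hBpos : ∀ s, (B s).IsPositive := fun s => hT.isPositive.conj_adjoint _
  have hApos : ∀ s, ((w s : ℂ) • B s).IsPositive := fun s => isPositive_ofReal_smul (hw s) (hBpos s)
  -- Partial trace over ℂ^ι of the identity `h1`; hence the operators A_s have total trace tr T = 1.
  have hAsum : ∑ s, (w s : ℂ) • B s = ∑ a, block T a a := by
    simp only [hB, bra_conj, Finset.smul_sum, smul_smul]
    rw [Finset.sum_comm]
    refine Finset.sum_congr rfl fun b _ => ?_
    rw [← h1 b b]
    refine Finset.sum_congr rfl fun s _ => Finset.sum_congr rfl fun a _ => ?_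
    congr 1; ring
  have hAtr : ∑ s, posTrace ((w s : ℂ) • B s) = 1 := by
    rw [← posTrace_sum _ _ fun s _ => hApos s, hAsum,
      posTrace_sum _ _ fun a _ => isPositive_block hT.isPositive a,
      ← posTrace_eq_sum_block hT.isPositive, hT.trace_eq_one]
  set K := partialTraceAlong e T with hK
  have hKpos : K.IsPositive := isPositive_partialTraceAlong e hT.isPositive
  have hKtr : posTrace K = 1 := by
    rw [hK, posTrace_partialTraceAlong he hT.isPositive, hT.trace_eq_one]
  set τ : PiLp 2 (fun _ : κ => H) →L[ℂ] PiLp 2 (fun _ : κ => H) :=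
    ∑ s, ContinuousLinearMap.adjoint (bra H (u s)) ∘L ((w s : ℂ) • B s) ∘L bra H (u s) with hτ
  have hτpos : τ.IsPositive :=
    ContinuousLinearMap.isPositive_sum _ fun s _ => (hApos s).adjoint_conj _
  have hτblock : ∀ i j, block τ i j = ∑ s, (u s i * star (u s j)) • ((w s : ℂ) • B s) := by
    intro i j
    rw [hτ, block_sum]
    exact Finset.sum_congr rfl fun s _ => block_bra_bra _ _ _ _
  have hτtr : posTrace τ = 1 := by
    have h3 : ∀ s i, u s i * star (u s i) = ((‖u s i‖ ^ 2 : ℝ) : ℂ) := by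
      intro s i
      rw [Complex.ofReal_pow, ← Complex.mul_conj']
      rfl
    have hu' : ∀ s, ∑ i, ‖u s i‖ ^ 2 = 1 := by
      intro s
      have := hu s
      simp only [h3] at this
      exact_mod_cast this
    rw [posTrace_eq_sum_block hτpos, ← hAtr]
    have : ∀ i, posTrace (block τ i i) =
        ∑ s, ENNReal.ofReal (‖u s i‖ ^ 2) * posTrace ((w s : ℂ) • B s) := by
      intro i
      rw [hτblock, posTrace_sum]
      · refine Finset.sum_congr rfl fun s _ => ?_
        rw [h3, posTrace_smul (by positivity)]
      · intro s _
        rw [h3]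
        exact isPositive_ofReal_smul (by positivity) (hApos s)
    simp only [this]
    rw [Finset.sum_comm]
    refine Finset.sum_congr rfl fun s _ => ?_
    rw [← Finset.sum_mul, ← ENNReal.ofReal_sum_of_nonneg (fun _ _ => by positivity), hu',
      ENNReal.ofReal_one, one_mul]
  set Y : S → PiLp 2 (fun _ : κ => H) →L[ℂ] PiLp 2 (fun _ : κ => H) := fun s =>
    (w s : ℂ) • (braAt H e (v s) ∘L T ∘L ContinuousLinearMap.adjoint (braAt H e (v s))) with hY
  have hYpos : ∀ s, (Y s).IsPositive := fun s =>
    isPositive_ofReal_smul (hw s) (hT.isPositive.conj_adjoint _)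
  set p : S → PiLp 2 (fun _ : κ => H) →L[ℂ] PiLp 2 (fun _ : κ => H) := fun s =>
    ContinuousLinearMap.adjoint (bra H (u s)) ∘L bra H (u s) with hp
  have hpadj : ∀ s, ContinuousLinearMap.adjoint (p s) = p s := fun s => by
    simp [hp, ContinuousLinearMap.adjoint_comp]
  have hYadj : ∀ s, ContinuousLinearMap.adjoint (Y s) = Y s := fun s =>
    (hYpos s).isSelfAdjoint.adjoint_eq
  have E1 : ∑ s, Y s = (c : ℂ) • K := by
    refine ext_block fun i j => ?_
    rw [block_sum, block_smul, hK, block_partialTraceAlong, Finset.smul_sum]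
    simp only [hY, block_smul, block_braAt, Finset.smul_sum, smul_smul]
    rw [Finset.sum_comm]
    refine Finset.sum_congr rfl fun l _ => ?_
    rw [← h2 i l]
    refine Finset.sum_congr rfl fun s _ => Finset.sum_congr rfl fun l' _ => ?_
    congr 1; ring
  have hcomp : ∀ s, bra H (u s) ∘L braAt H e (v s) = bra H (Ψ s) := fun s =>
    bra_comp_braAt e he _ _ _ (hΨ s)
  -- ⟨u_s| after ⟨v_s| is ⟨Ψ_s|, while the ket u_s and the right-hand v_s supply the entries of
  -- |Ψ_s⟩. So the sum is the partial trace of (∑ w_s |Ψ_s⟩⟨Ψ_s|) T = T.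
  have E2 : ∑ s, p s ∘L Y s = K := by
    refine ext_block fun i j => ?_
    rw [block_sum, hK, block_partialTraceAlong]
    have hblk : ∀ s, block (p s ∘L Y s) i j =
        ∑ l, ∑ a', ((w s : ℂ) * (Ψ s (e i l) * star (Ψ s a'))) • block T a' (e j l) := by
      intro s
      have h3 : block (p s ∘L Y s) i j = (w s : ℂ) •
          ((coord H i ∘L ContinuousLinearMap.adjoint (bra H (u s))) ∘L
          (bra H (u s) ∘L braAt H e (v s)) ∘L T ∘L
            ContinuousLinearMap.adjoint (coord H j ∘L braAt H e (v s))) := by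
        rw [ContinuousLinearMap.adjoint_comp]
        ext x
        simp [block, hp, hY]
      rw [h3, coord_comp_adjoint_bra, hcomp, coord_comp_braAt, bra]
      ext x
      simp only [map_sum, map_smulₛₗ, hΨ, block, ContinuousLinearMap.comp_apply, _root_.sum_apply,
        _root_.smul_apply, starRingEnd_apply, star_star, Finset.smul_sum, smul_smul,
        RingHom.id_apply, one_apply_eq_self]
      refine Finset.sum_congr rfl fun l _ => Finset.sum_congr rfl fun a _ => ?_
      congr 1
      ring
    simp only [hblk]
    rw [Finset.sum_comm]
    exact Finset.sum_congr rfl fun l _ => h1 _ _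
  have E3 : ∑ s, Y s ∘L p s = K := by
    have := congrArg ContinuousLinearMap.adjoint E2
    rw [hKpos.isSelfAdjoint.adjoint_eq, map_sum] at this
    rw [← this]
    refine Finset.sum_congr rfl fun s _ => ?_
    rw [ContinuousLinearMap.adjoint_comp, hYadj, hpadj]
  have E4 : ∑ s, p s ∘L Y s ∘L p s = τ := by
    refine Finset.sum_congr rfl fun s _ => ?_
    simp only [hB]
    rw [← hcomp, ContinuousLinearMap.adjoint_comp]
    ext x
    simp [hp, hY]
  set r : ℝ := 1 / c with hr
  have hr0 : 0 ≤ r := by positivity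
  have hr1 : r ≤ 1 := by rw [hr, div_le_one (by linarith)]; exact hc
  have hrc : (r : ℂ) * c = 1 := by
    rw [hr]; push_cast; rw [one_div, inv_mul_cancel₀]
    exact_mod_cast (by linarith : c ≠ 0)
  set Ω : PiLp 2 (fun _ : κ => H) →L[ℂ] PiLp 2 (fun _ : κ => H) :=
    (r : ℂ) • ∑ s, (1 - p s) ∘L Y s ∘L ContinuousLinearMap.adjoint (1 - p s) with hΩ
  have hΩpos : Ω.IsPositive := isPositive_ofReal_smul hr0
    (ContinuousLinearMap.isPositive_sum _ fun s _ => (hYpos s).conj_adjoint _)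
  have hΩeq : Ω + (r : ℂ) • K + (r : ℂ) • K = K + (r : ℂ) • τ := by
    have h4 : ∀ s, (1 - p s) ∘L Y s ∘L ContinuousLinearMap.adjoint (1 - p s) =
        Y s - p s ∘L Y s - Y s ∘L p s + p s ∘L Y s ∘L p s := by
      intro s
      have : ContinuousLinearMap.adjoint (1 - p s) = 1 - p s := by
        rw [map_sub, hpadj]
        congr 1
        exact ContinuousLinearMap.adjoint_id
      rw [this]
      ext1 x
      simp only [ContinuousLinearMap.comp_apply, _root_.sub_apply,
        _root_.add_apply, one_apply_eq_self, map_sub]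
      abel
    rw [hΩ, Finset.sum_congr rfl fun s _ => h4 s, Finset.sum_add_distrib, Finset.sum_sub_distrib,
      Finset.sum_sub_distrib, E1, E2, E3, E4, smul_add, smul_sub, smul_sub, smul_smul, hrc,
      one_smul]
    abel
  obtain ⟨P, Q, hP, hQ, hPQ, hle⟩ :=
    exists_sub_of_residue ⟨hKpos, hKtr⟩ ⟨hτpos, hτtr⟩ hΩpos hr0 hr1 hΩeq
  exact ⟨fun s => (w s : ℂ) • B s, τ, P, Q, hApos, hAtr, ⟨hτpos, hτtr⟩, hτblock, hP, hQ, hPQ, hle⟩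

end Mixture

/-! ### Moments of the complex Gaussian -/

section Wick

open Nat

/-- The solutions π are empty unless the letter multiplicities agree, and otherwise form a coset of
the stabiliser of `i`. The product over letters is the shape in which Gaussian moments factor. -/
theorem sum_perm_comp_eq {α D : Type*} [Fintype α] [DecidableEq α] [Fintype D] [DecidableEq D]
    (i j : α → D) :
    (∑ π : Equiv.Perm α, if i ∘ π = j then 1 else 0 : ℕ) =
      ∏ a, if Fintype.card {t // i t = a} = Fintype.card {t // j t = a} then
        (Fintype.card {t // i t = a})! else 0 := by
  by_cases h : ∀ a, Fintype.card {t // i t = a} = Fintype.card {t // j t = a}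
  · have e : ∀ a, {t // j t = a} ≃ {t // i t = a} := fun a => Fintype.equivOfCardEq (h a).symm
    let π₀ : Equiv.Perm α := (Equiv.sigmaFiberEquiv j).symm.trans
      ((Equiv.sigmaCongrRight e).trans (Equiv.sigmaFiberEquiv i))
    have h0 : i ∘ π₀ = j := by
      funext t
      exact (e (j t) ⟨t, rfl⟩).2
    simp only [h, if_true]
    have h1 := DomMulAct.stabilizer_card i
    simp only [h] at h1
    rw [← h1, Fintype.card_subtype, Finset.card_filter]
    refine Fintype.sum_equiv (Equiv.mulRight π₀⁻¹) _ _ fun π => ?_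
    have : i ∘ π = j ↔ i ∘ (Equiv.mulRight π₀⁻¹ π) = i := by
      rw [← h0]
      constructor
      · intro h2
        funext t
        have := congrFun h2 (π₀⁻¹ t)
        simpa using this
      · intro h2
        funext t
        have := congrFun h2 (π₀ t)
        simpa using this
    simp only [this]
  · have h' := h
    push Not at h
    obtain ⟨a, ha⟩ := h
    rw [Finset.prod_eq_zero (Finset.mem_univ a) (by simp [ha])]
    refine Finset.sum_eq_zero fun π _ => if_neg fun hπ => h' fun b => ?_
    refine Fintype.card_congr (π.symm.subtypeEquiv fun t => ?_)
    rw [← hπ]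
    simp

theorem integrable_pow_mul_gaussian (p q : ℕ) :
    MeasureTheory.Integrable (fun z : ℂ => z ^ p * star z ^ q * (Real.exp (-‖z‖ ^ 2) : ℂ)) := by
  have h1 : MeasureTheory.Integrable
      (fun z : ℂ => ‖z‖ ^ ((p + q : ℕ) : ℝ) * Real.exp (-‖z‖ ^ (2 : ℝ))) := by
    -- The Bochner integral of a non-integrable function is 0, so the nonzero Gamma value proves
    -- integrability.
    refine MeasureTheory.Integrable.of_integral_ne_zero ?_
    have hq : (-2 : ℝ) < ((p + q : ℕ) : ℝ) := by
      have : (0 : ℝ) ≤ ((p + q : ℕ) : ℝ) := Nat.cast_nonneg _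
      linarith
    rw [Complex.integral_rpow_mul_exp_neg_rpow (by norm_num) hq]
    have : 0 < Real.Gamma ((((p + q : ℕ) : ℝ) + 2) / 2) := Real.Gamma_pos_of_pos (by positivity)
    positivity
  refine h1.mono (by fun_prop) (Filter.Eventually.of_forall fun z => ?_)
  simp only [norm_mul, norm_pow, norm_star, Complex.norm_real, Real.norm_eq_abs,
    Real.rpow_natCast, Real.rpow_two, pow_add]
  gcongr <;> simp [abs_of_nonneg]

theorem integral_pow_mul_gaussian (p q : ℕ) :
    ∫ z : ℂ, z ^ p * star z ^ q * (Real.exp (-‖z‖ ^ 2) : ℂ) =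
      Real.pi * (if p = q then p ! else 0 : ℕ) := by
  by_cases h : p = q
  · subst h
    rw [if_pos rfl]
    have h1 := Complex.integral_rpow_mul_exp_neg_rpow (p := 2) (q := ((2 * p : ℕ) : ℝ))
      (by norm_num) (by have : (0 : ℝ) ≤ ((2 * p : ℕ) : ℝ) := Nat.cast_nonneg _
                        linarith)
    have h2 : ∀ z : ℂ, z ^ p * star z ^ p * (Real.exp (-‖z‖ ^ 2) : ℂ) =
        ((‖z‖ ^ ((2 * p : ℕ) : ℝ) * Real.exp (-‖z‖ ^ (2 : ℝ)) : ℝ) : ℂ) := by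
      intro z
      rw [Real.rpow_natCast, Real.rpow_two, ← mul_pow, pow_mul]
      have : z * star z = ((‖z‖ ^ 2 : ℝ) : ℂ) := by
        rw [Complex.ofReal_pow, ← Complex.mul_conj']; rfl
      rw [this]
      push_cast
      rfl
    simp only [h2]
    rw [integral_complex_ofReal, h1]
    have h3 : (((2 * p : ℕ) : ℝ) + 2) / 2 = (p : ℝ) + 1 := by push_cast; ring
    rw [h3, Real.Gamma_nat_eq_factorial]
    push_cast
    ring
  · rw [if_neg h]
    set F : ℂ → ℂ := fun z => z ^ p * star z ^ q * (Real.exp (-‖z‖ ^ 2) : ℂ) with hF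
    -- a phase whose powers `p` and `q` differ
    set θ : ℝ := Real.pi / (p - q : ℝ) with hθ
    have hpq : (p - q : ℝ) ≠ 0 := sub_ne_zero.2 (by exact_mod_cast h)
    set ω : Circle := Circle.exp θ with hω
    have hωpq : (ω : ℂ) ^ p * star (ω : ℂ) ^ q = -1 := by
      have h3 : star (ω : ℂ) = Complex.exp (-(θ * Complex.I)) := by
        rw [hω, Circle.coe_exp]
        change (starRingEnd ℂ) _ = _
        rw [← Complex.exp_conj]
        simp
      rw [h3, hω, Circle.coe_exp, ← Complex.exp_nat_mul, ← Complex.exp_nat_mul, ← Complex.exp_add]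
      have h4 : (p : ℂ) * (θ * Complex.I) + q * (-(θ * Complex.I)) = Real.pi * Complex.I := by
        have h5 : (p - q : ℂ) * θ = Real.pi := by
          rw [hθ]
          exact_mod_cast (mul_div_cancel₀ Real.pi hpq)
        rw [← h5]
        ring
      rw [h4, Complex.exp_pi_mul_I]
    -- Rotation by ω preserves the measure and sends `F` to `-F`, so the integral is its own
    -- negative.
    have h6 := (rotation ω).measurePreserving.integral_comp
      (rotation ω).toHomeomorph.measurableEmbedding F
    have h7 : ∀ z, F (rotation ω z) = -F z := by
      intro z
      simp only [hF, rotation_apply, norm_mul, Circle.norm_coe, one_mul, mul_pow, star_mul']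
      linear_combination (z ^ p * star z ^ q * (Real.exp (-‖z‖ ^ 2) : ℂ)) * hωpq
    simp only [h7] at h6
    rw [MeasureTheory.integral_neg] at h6
    have : ∫ z, F z = 0 := by linear_combination -(1 / 2 : ℂ) * h6
    rw [this]
    simp

variable {α D : Type*} [Fintype α] [DecidableEq α] [Fintype D] [DecidableEq D]

omit [DecidableEq α] in
theorem prod_comp_eq_prod_pow (i : α → D) (f : D → ℂ) :
    ∏ t, f (i t) = ∏ a, f a ^ Fintype.card {t // i t = a} := by
  rw [← Finset.prod_fiberwise Finset.univ i]
  refine Finset.prod_congr rfl fun a _ => ?_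
  rw [Finset.prod_congr rfl (g := fun _ => f a) fun t ht => by rw [(Finset.mem_filter.1 ht).2],
    Finset.prod_const, Fintype.card_subtype]

omit [DecidableEq α] in
theorem gaussian_monomial_eq (i j : α → D) (z : D → ℂ) :
    (∏ t, z (i t) * star (z (j t))) * ∏ a, (Real.exp (-‖z a‖ ^ 2) : ℂ) =
      ∏ a, (z a ^ Fintype.card {t // i t = a} * star (z a) ^ Fintype.card {t // j t = a} *
        (Real.exp (-‖z a‖ ^ 2) : ℂ)) := by
  rw [Finset.prod_mul_distrib, prod_comp_eq_prod_pow i z,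
    prod_comp_eq_prod_pow j fun a => star (z a), Finset.prod_mul_distrib, Finset.prod_mul_distrib]

omit [DecidableEq α] in
theorem integrable_gaussian_monomial (i j : α → D) :
    MeasureTheory.Integrable (fun z : D → ℂ =>
      (∏ t, z (i t) * star (z (j t))) * ∏ a, (Real.exp (-‖z a‖ ^ 2) : ℂ)) := by
  simp only [gaussian_monomial_eq]
  exact MeasureTheory.Integrable.fintype_prod (f := fun a (x : ℂ) =>
    x ^ Fintype.card {t // i t = a} * star x ^ Fintype.card {t // j t = a} *
      (Real.exp (-‖x‖ ^ 2) : ℂ)) fun a => integrable_pow_mul_gaussian _ _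

/-- Wick's formula for the Gaussian measure on `ℂ^D`. -/
theorem integral_gaussian_monomial (i j : α → D) :
    ∫ z : D → ℂ, (∏ t, z (i t) * star (z (j t))) * ∏ a, (Real.exp (-‖z a‖ ^ 2) : ℂ) =
      (Real.pi : ℂ) ^ Fintype.card D *
        (∑ π : Equiv.Perm α, if i ∘ π = j then 1 else 0 : ℕ) := by
  simp only [gaussian_monomial_eq]
  rw [MeasureTheory.integral_fintype_prod_volume_eq_prod (f := fun a (x : ℂ) =>
    x ^ Fintype.card {t // i t = a} * star x ^ Fintype.card {t // j t = a} *
      (Real.exp (-‖x‖ ^ 2) : ℂ))]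
  simp only [integral_pow_mul_gaussian]
  rw [Finset.prod_mul_distrib, Finset.prod_const, sum_perm_comp_eq, Nat.cast_prod]
  rfl

end Wick

/-! ### Compactness of convex hulls in finite dimension -/

section ConvexHull

/-- By Carathéodory, dim + 1 points suffice, so the hull is a continuous image of a simplex times a
power of `s`. -/
theorem isCompact_convexHull_of_finiteDimensional {E : Type*} [NormedAddCommGroup E]
    [NormedSpace ℝ E] [FiniteDimensional ℝ E] {s : Set E} (hs : IsCompact s) :
    IsCompact (convexHull ℝ s) := by
  set m := Module.finrank ℝ E + 1 with hm
  have hK : IsCompact (stdSimplex ℝ (Fin m) ×ˢ Set.pi Set.univ (fun _ : Fin m => s)) :=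
    (isCompact_stdSimplex ℝ (Fin m)).prod (isCompact_univ_pi fun _ => hs)
  have hf : Continuous fun p : (Fin m → ℝ) × (Fin m → E) => ∑ i, p.1 i • p.2 i := by fun_prop
  convert hK.image hf using 1
  apply Set.Subset.antisymm
  · intro x hx
    obtain ⟨ι, hι, z, w, hz, hind, hw, hw1, hx⟩ := eq_pos_convex_span_of_mem_convexHull hx
    have hcard : Fintype.card ι ≤ Fintype.card (Fin m) := by
      rw [Fintype.card_fin]
      exact hind.card_le_finrank_succ.trans (Nat.succ_le_succ (Submodule.finrank_le _))
    obtain ⟨g⟩ := Function.Embedding.nonempty_of_card_le hcard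
    have hne : Nonempty ι := by
      by_contra h
      rw [not_nonempty_iff] at h
      simp at hw1
    obtain ⟨i₀⟩ := hne
    have hout : ∀ k ∉ Set.range g, Function.extend g w 0 k = 0 := fun k hk => by
      rw [Function.extend_apply' _ _ _ (by simpa using hk)]; rfl
    -- Unused slots get weight 0 and the point `z i₀`, which keeps them in `s`.
    refine ⟨(Function.extend g w 0, Function.extend g z fun _ => z i₀), ⟨⟨fun k => ?_, ?_⟩, ?_⟩, ?_⟩
    · by_cases hk : k ∈ Set.range g
      · obtain ⟨i, rfl⟩ := hk
        simp only [g.injective.extend_apply]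
        exact (hw i).le
      · exact (hout k hk).ge
    · rw [← hw1]
      exact (Fintype.sum_of_injective g g.injective w _ hout
        fun i => (g.injective.extend_apply _ _ _).symm).symm
    · intro k _
      by_cases hk : k ∈ Set.range g
      · obtain ⟨i, rfl⟩ := hk
        simp only [g.injective.extend_apply]
        exact hz ⟨i, rfl⟩
      · simp only
        rw [Function.extend_apply' _ _ _ (by simpa using hk)]
        exact hz ⟨i₀, rfl⟩
    · rw [← hx]
      refine (Fintype.sum_of_injective g g.injective (fun i => w i • z i) _ (fun k hk => ?_)
        fun i => ?_).symm
      · simp only [hout k hk, zero_smul]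
      · simp only [g.injective.extend_apply]
  · rintro _ ⟨⟨w, z⟩, ⟨⟨hw0, hw1⟩, hz⟩, rfl⟩
    exact mem_convexHull_of_exists_fintype w z hw0 hw1 (fun i => hz i trivial) rfl

end ConvexHull

/-! ### A finite resolution of the symmetric projection by product vectors -/

section Design

open MeasureTheory

variable {α D : Type*} [Fintype α] [DecidableEq α] [Fintype D] [DecidableEq D]

/-- The matrix of `φ^{⊗ α} (φ^{⊗ α})†`. -/
def ketbraPower (α : Type*) [Fintype α] (φ : D → ℂ) (i j : α → D) : ℂ :=
  ∏ t, φ (i t) * star (φ (j t))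

/-- The number of permutations taking the word `i` to the word `j`. -/
def permCount (i j : α → D) : ℕ := ∑ π : Equiv.Perm α, if i ∘ π = j then 1 else 0

omit [DecidableEq α] [Fintype D] [DecidableEq D] in
theorem ketbraPower_smul (r : ℝ) (φ : D → ℂ) :
    ketbraPower α (fun a => (r : ℂ) * φ a) = (r ^ 2) ^ Fintype.card α • ketbraPower α φ := by
  funext i j
  simp only [ketbraPower, Pi.smul_apply, Complex.real_smul]
  have : ∀ t : α, (r : ℂ) * φ (i t) * star ((r : ℂ) * φ (j t)) =
      (r : ℂ) ^ 2 * (φ (i t) * star (φ (j t))) := by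
    intro t
    rw [star_mul']
    have : star (r : ℂ) = r := Complex.conj_ofReal r
    rw [this]; ring
  simp only [this]
  rw [Finset.prod_mul_distrib, Finset.prod_const, Finset.card_univ]
  push_cast
  rfl

omit [DecidableEq α] [Fintype D] [DecidableEq D] in
theorem continuous_ketbraPower : Continuous (ketbraPower (D := D) α) := by
  unfold ketbraPower
  fun_prop

omit [DecidableEq D] in
theorem sum_ketbraPower_self (φ : D → ℂ) :
    ∑ i : α → D, ketbraPower α φ i i = (∑ a, φ a * star (φ a)) ^ Fintype.card α := by
  unfold ketbraPower
  rw [← Finset.card_univ, ← Finset.prod_const, Finset.prod_univ_sum, Fintype.piFinset_univ]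

omit [DecidableEq D] in
theorem sum_mul_star (φ : D → ℂ) :
    ∑ a, φ a * star (φ a) = ((∑ a, ‖φ a‖ ^ 2 : ℝ) : ℂ) := by
  push_cast
  refine Finset.sum_congr rfl fun a _ => ?_
  rw [← Complex.mul_conj']; rfl

omit [DecidableEq D] in
theorem isCompact_unitVectors : IsCompact {φ : D → ℂ | ∑ a, ‖φ a‖ ^ 2 = 1} := by
  refine Metric.isCompact_of_isClosed_isBounded (isClosed_eq (by fun_prop) continuous_const) ?_
  refine (Metric.isBounded_closedBall (x := (0 : D → ℂ)) (r := 1)).subset fun φ hφ => ?_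
  rw [mem_closedBall_zero_iff, pi_norm_le_iff_of_nonneg zero_le_one]
  intro a
  have : ‖φ a‖ ^ 2 ≤ 1 := by
    rw [← (show ∑ a, ‖φ a‖ ^ 2 = 1 from hφ)]
    exact Finset.single_le_sum (f := fun a => ‖φ a‖ ^ 2) (fun _ _ => by positivity)
      (Finset.mem_univ a)
  exact (sq_le_one_iff₀ (norm_nonneg _)).1 this

omit [Fintype D] in
theorem permCount_self_pos (i : α → D) : 0 < permCount i i := by
  unfold permCount
  refine Finset.sum_pos' (fun _ _ => Nat.zero_le _) ⟨1, Finset.mem_univ _, ?_⟩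
  rw [if_pos (by rfl)]
  exact one_pos

/-- By Wick's formula the Gaussian average of |z^{⊗n}⟩⟨z^{⊗n}| is a multiple of the symmetric
projection. Normalised to trace one, it lies in the closed convex hull of the pure powers, by
Hahn–Banach separation. The hull is already closed, so a finite convex combination attains it. -/
theorem exists_design [Nonempty α] [Nonempty D] :
    ∃ (S : Type) (_ : Fintype S) (w : S → ℝ) (φ : S → D → ℂ), (∀ s, 0 ≤ w s) ∧
      (∀ s, ∑ a, φ s a * star (φ s a) = 1) ∧
      ∀ i j : α → D, ∑ s, (w s : ℂ) * ketbraPower α (φ s) i j =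
        permCount i j / (Fintype.card α).factorial := by
  set n := Fintype.card α with hn
  set g : (D → ℂ) → ℝ := fun z => ∏ a, Real.exp (-‖z a‖ ^ 2) with hg
  have hg0 : ∀ z, 0 ≤ g z := fun z => Finset.prod_nonneg fun a _ => (Real.exp_pos _).le
  set N : (D → ℂ) → ℝ := fun z => ∑ a, ‖z a‖ ^ 2 with hN
  have hN0 : ∀ z, 0 ≤ N z := fun z => Finset.sum_nonneg fun a _ => by positivity
  set f : (D → ℂ) → ((α → D) → (α → D) → ℂ) := fun z => g z • ketbraPower α z with hf
  have hfij : ∀ z i j, f z i j =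
      (∏ t, z (i t) * star (z (j t))) * ∏ a, (Real.exp (-‖z a‖ ^ 2) : ℂ) := by
    intro z i j
    simp only [hf, hg, Pi.smul_apply, Complex.real_smul, ketbraPower]
    push_cast
    ring
  have hfi : Integrable f := by
    refine Integrable.of_eval fun i => Integrable.of_eval fun j => ?_
    simp only [hfij]
    exact integrable_gaussian_monomial i j
  set G : (α → D) → (α → D) → ℂ := ∫ z, f z with hG
  have hGij : ∀ i j, G i j = (Real.pi : ℂ) ^ Fintype.card D * (permCount i j : ℕ) := by
    intro i j
    rw [hG, eval_integral (fun i => Integrable.eval hfi i),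
      eval_integral (fun j => Integrable.eval (Integrable.eval hfi i) j)]
    simp only [hfij]
    exact integral_gaussian_monomial i j
  -- The trace of `G`.
  set Z : ℝ := Real.pi ^ Fintype.card D * ∑ i : α → D, (permCount i i : ℝ) with hZ
  have hZpos : 0 < Z := by
    refine mul_pos (pow_pos Real.pi_pos _) (Finset.sum_pos (fun i _ => ?_) Finset.univ_nonempty)
    exact_mod_cast permCount_self_pos i
  have htr : ∀ z, ((N z ^ n * g z : ℝ) : ℂ) = ∑ i, f z i i := by
    intro z
    have : ∀ i, f z i i = (g z : ℂ) * ketbraPower α z i i := fun i => by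
      simp [hf]
    simp only [this]
    rw [← Finset.mul_sum, sum_ketbraPower_self, sum_mul_star]
    rw [Complex.ofReal_mul, Complex.ofReal_pow, mul_comm]
  have htri : Integrable (fun z => ((N z ^ n * g z : ℝ) : ℂ)) := by
    simp only [htr]
    exact integrable_finsetSum _ fun i _ => Integrable.eval (Integrable.eval hfi i) i
  have hNi : Integrable (fun z => N z ^ n * g z) := htri.re
  have hNZ : ∫ z, N z ^ n * g z = Z := by
    have h1 : ((∫ z, N z ^ n * g z : ℝ) : ℂ) = (Z : ℂ) := by
      rw [← integral_complex_ofReal]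
      simp only [htr]
      rw [integral_finsetSum _ fun i _ => Integrable.eval (Integrable.eval hfi i) i]
      have : ∀ i, ∫ z, f z i i = (Real.pi : ℂ) ^ Fintype.card D * (permCount i i : ℕ) := by
        intro i
        simp only [hfij]
        exact integral_gaussian_monomial i i
      simp only [this, hZ]
      push_cast
      rw [Finset.mul_sum]
    exact_mod_cast h1
  have hmem : Z⁻¹ • G ∈ convexHull ℝ (ketbraPower α '' {φ : D → ℂ | ∑ a, ‖φ a‖ ^ 2 = 1}) := by
    by_contra hnot
    have hcl : IsClosed (convexHull ℝ
        (ketbraPower α '' {φ : D → ℂ | ∑ a, ‖φ a‖ ^ 2 = 1})) :=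
      (isCompact_convexHull_of_finiteDimensional
        (isCompact_unitVectors.image continuous_ketbraPower)).isClosed
    obtain ⟨ℓ, c, hℓ, hc⟩ := geometric_hahn_banach_closed_point (convex_convexHull ℝ _) hcl hnot
    -- The bound on unit vectors extends by homogeneity of degree n in |z|². At z = 0 both sides
    -- vanish because n > 0.
    have hpt : ∀ z, ℓ (f z) ≤ c * (N z ^ n * g z) := by
      intro z
      have hfz : ℓ (f z) = g z * ℓ (ketbraPower α z) := by simp [hf]
      have key : ℓ (ketbraPower α z) ≤ c * N z ^ n := by
        rcases (hN0 z).eq_or_lt with h0 | h0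
        · have hz : ∀ a, z a = 0 := by
            intro a
            have := (Finset.sum_eq_zero_iff_of_nonneg (fun a _ => by positivity)).1 h0.symm a
              (Finset.mem_univ a)
            simpa using this
          have : ketbraPower α z = 0 := by
            funext i j
            simp only [ketbraPower, hz]
            simp
          rw [this, ← h0, map_zero, zero_pow Fintype.card_ne_zero, mul_zero]
        · set ρ := Real.sqrt (N z) with hρ
          have hρ0 : 0 < ρ := Real.sqrt_pos.2 h0
          have hρ2 : ρ ^ 2 = N z := Real.sq_sqrt (hN0 z)
          set y : D → ℂ := fun a => ((ρ⁻¹ : ℝ) : ℂ) * z a with hy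
          have hzy : z = fun a => (ρ : ℂ) * y a := by
            funext a
            simp only [hy]
            rw [← mul_assoc, ← Complex.ofReal_mul, mul_inv_cancel₀ hρ0.ne', Complex.ofReal_one,
              one_mul]
          have hy1 : ∑ a, ‖y a‖ ^ 2 = 1 := by
            simp only [hy, norm_mul, Complex.norm_real, Real.norm_eq_abs, mul_pow, sq_abs]
            rw [← Finset.mul_sum, inv_pow, hρ2]
            exact inv_mul_cancel₀ h0.ne'
          have h2 := hℓ _ (subset_convexHull ℝ _ ⟨y, hy1, rfl⟩)
          rw [hzy, ketbraPower_smul, hρ2, map_smul, ← hzy, smul_eq_mul, mul_comm]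
          exact mul_le_mul_of_nonneg_right h2.le (pow_nonneg (hN0 z) _)
      rw [hfz]
      nlinarith [mul_le_mul_of_nonneg_left key (hg0 z)]
    have h3 : ℓ G ≤ c * Z := by
      rw [hG, ← ContinuousLinearMap.integral_comp_comm ℓ hfi, ← hNZ, ← integral_const_mul]
      exact integral_mono (ℓ.integrable_comp hfi) (hNi.const_mul c) hpt
    rw [map_smul, smul_eq_mul] at hc
    have : Z⁻¹ * ℓ G ≤ c := by
      rw [inv_mul_le_iff₀ hZpos]
      linarith
    linarith
  rw [mem_convexHull_iff_exists_fintype] at hmem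
  obtain ⟨S, hS, c, x, hc0, -, hx, hsum⟩ := hmem
  choose φ hφ hφx using hx
  have hpi : 0 < Real.pi ^ Fintype.card D * (n.factorial : ℝ) := by positivity
  -- The factor turns the trace-one operator `Z⁻¹ • G` into the symmetric projection, so the weights
  -- sum to the dimension of the symmetric subspace.
  refine ⟨S, hS, fun s => c s * (Z / (Real.pi ^ Fintype.card D * n.factorial)), φ,
    fun s => mul_nonneg (hc0 s) (div_pos hZpos hpi).le, fun s => ?_, fun i j => ?_⟩
  · rw [sum_mul_star, show ∑ a, ‖φ s a‖ ^ 2 = 1 from hφ s, Complex.ofReal_one]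
  · have h4 := congrFun (congrFun hsum i) j
    simp only [Finset.sum_apply, Pi.smul_apply, Complex.real_smul, ← hφx, hGij] at h4
    have h5 : ∀ s, ((c s * (Z / (Real.pi ^ Fintype.card D * n.factorial)) : ℝ) : ℂ) *
        ketbraPower α (φ s) i j =
        ((Z / (Real.pi ^ Fintype.card D * n.factorial) : ℝ) : ℂ) * ((c s : ℂ) * ketbraPower α (φ s) i j) := by
      intro s; push_cast; ring
    simp only [h5]
    rw [← Finset.mul_sum, h4]
    have hZ' : (Z : ℂ) ≠ 0 := by exact_mod_cast hZpos.ne'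
    have hpi' : (Real.pi : ℂ) ≠ 0 := by exact_mod_cast Real.pi_ne_zero
    have hn' : (n.factorial : ℂ) ≠ 0 := by exact_mod_cast Nat.factorial_ne_zero n
    push_cast
    field_simp

end Design

/-! ### Partial traces of the symmetric projection -/

section Marginal

variable {D : Type*} [Fintype D] [DecidableEq D]

omit [Fintype D] in
theorem card_fiber_cons {n : ℕ} (a b : D) (i : Fin n → D) :
    Fintype.card {t // (Fin.cons a i : Fin (n + 1) → D) t = b} =
      Fintype.card {t // i t = b} + if a = b then 1 else 0 := by
  rw [Fintype.card_subtype, Fintype.card_subtype, Finset.card_filter, Finset.card_filter,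
    Fin.sum_univ_succ]
  simp [add_comm]

theorem sum_card_fiber {n : ℕ} (i : Fin n → D) : ∑ a, Fintype.card {t // i t = a} = n := by
  rw [← Fintype.card_sigma, Fintype.card_congr (Equiv.sigmaFiberEquiv i), Fintype.card_fin]

/-- Prefixing both words by `a` raises one multiplicity by 1, hence multiplies the count by
(multiplicity of `a` in `i`) + 1. These factors sum to n + |D|. -/
theorem sum_permCount_cons {n : ℕ} (i j : Fin n → D) :
    ∑ a, permCount (Fin.cons a i : Fin (n + 1) → D) (Fin.cons a j) =
      (n + Fintype.card D) * permCount i j := by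
  have h : ∀ a, permCount (Fin.cons a i : Fin (n + 1) → D) (Fin.cons a j) =
      (Fintype.card {t // i t = a} + 1) * permCount i j := by
    intro a
    unfold permCount
    rw [sum_perm_comp_eq, sum_perm_comp_eq]
    simp only [card_fiber_cons, add_left_inj]
    rw [← Finset.mul_prod_erase _ _ (Finset.mem_univ a),
      ← Finset.mul_prod_erase Finset.univ _ (Finset.mem_univ a), ← mul_assoc]
    congr 1
    · simp only [if_true]
      split_ifs
      · rw [Nat.factorial_succ]
      · simp
    · refine Finset.prod_congr rfl fun b hb => ?_
      rw [if_neg (Finset.ne_of_mem_erase hb).symm, add_zero]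
  simp only [h]
  rw [← Finset.sum_mul, Finset.sum_add_distrib, sum_card_fiber]
  simp

theorem design_marginal_succ {S : Type*} [Fintype S] {w : S → ℝ} {φ : S → D → ℂ}
    (hφ : ∀ s, ∑ a, φ s a * star (φ s a) = 1) {n : ℕ} {c : ℝ}
    (h : ∀ i j : Fin (n + 1) → D, ∑ s, (w s : ℂ) * ketbraPower _ (φ s) i j =
      c * (permCount i j / (n + 1).factorial)) (i j : Fin n → D) :
    ∑ s, (w s : ℂ) * ketbraPower _ (φ s) i j =
      ((c * ((n + Fintype.card D) / (n + 1)) : ℝ) : ℂ) * (permCount i j / n.factorial) := by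
  have h1 : ∀ s, (w s : ℂ) * ketbraPower _ (φ s) i j =
      ∑ a, (w s : ℂ) * ketbraPower _ (φ s) (Fin.cons a i : Fin (n + 1) → D) (Fin.cons a j) := by
    intro s
    simp only [ketbraPower, Fin.prod_univ_succ, Fin.cons_zero, Fin.cons_succ]
    rw [← Finset.mul_sum, ← Finset.sum_mul, hφ, one_mul]
  simp only [h1]
  rw [Finset.sum_comm]
  simp only [h]
  rw [← Finset.mul_sum, ← Finset.sum_div, ← Nat.cast_sum, sum_permCount_cons, Nat.factorial_succ]
  have hn' : (n.factorial : ℂ) ≠ 0 := by exact_mod_cast Nat.factorial_ne_zero n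
  have hn1 : (n + 1 : ℂ) ≠ 0 := by exact_mod_cast Nat.succ_ne_zero n
  push_cast
  field_simp

/-- One letter is removed at a time, and `c` is the product of the factors (m + |D|)/(m + 1), that
is, dim Sym^n / dim Sym^m. -/
theorem design_marginal [Nonempty D] {S : Type*} [Fintype S] {w : S → ℝ} {φ : S → D → ℂ}
    (hφ : ∀ s, ∑ a, φ s a * star (φ s a) = 1) {n : ℕ}
    (h : ∀ i j : Fin n → D, ∑ s, (w s : ℂ) * ketbraPower _ (φ s) i j = permCount i j / n.factorial)
    (k m : ℕ) (hkm : k + m = n) :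
    ∃ c : ℝ, 1 ≤ c ∧ 1 - 1 / c ≤ (Fintype.card D - 1) * k / n ∧
      ∀ i j : Fin m → D, ∑ s, (w s : ℂ) * ketbraPower _ (φ s) i j =
        c * (permCount i j / m.factorial) := by
  have hd : (1 : ℝ) ≤ Fintype.card D := by exact_mod_cast Fintype.card_pos
  induction k generalizing m with
  | zero =>
    obtain rfl : m = n := by omega
    exact ⟨1, le_rfl, by simp, by simpa using h⟩
  | succ k ih =>
    obtain ⟨c, hc1, hcn, hc⟩ := ih (m + 1) (by omega)
    refine ⟨_, ?_, ?_, design_marginal_succ hφ hc⟩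
    · have : 1 ≤ ((m : ℝ) + Fintype.card D) / (m + 1) := by
        rw [one_le_div (by positivity)]; linarith
      nlinarith
    · set e : ℝ := (Fintype.card D : ℝ) - 1 with he
      have hed : (Fintype.card D : ℝ) = e + 1 := by rw [he]; ring
      have he0 : 0 ≤ e := by linarith
      have hnn : (n : ℝ) = k + (m + 1) := by rw [← hkm]; push_cast; ring
      have hn0 : (0 : ℝ) < n := by rw [hnn]; positivity
      have hr : 1 / (c * ((m + Fintype.card D) / (m + 1))) =
          (1 / c) * ((m + 1) / (m + 1 + e)) := by
        rw [hed, one_div, mul_inv, inv_div, one_div]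
        ring_nf
      have h2 : (1 - e * k / n) * ((m + 1) / (m + 1 + e)) ≤ (1 / c) * ((m + 1) / (m + 1 + e)) :=
        mul_le_mul_of_nonneg_right (by linarith) (by positivity)
      -- Integrality matters: the induction step needs e(ek + e - k) ≥ 0, which can fail for 0 < e <
      -- 1.
      have he1 : e = 0 ∨ 1 ≤ e := by
        rcases (Nat.one_le_iff_ne_zero.2 (Fintype.card_ne_zero (α := D))).eq_or_lt with h4 | h4
        · left; rw [he, ← h4]; simp
        · right
          have : (2 : ℝ) ≤ Fintype.card D := by exact_mod_cast h4
          linarith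
      have h3 : 1 - e * ((k + 1 : ℕ) : ℝ) / n ≤ (1 - e * k / n) * ((m + 1) / (m + 1 + e)) := by
        rcases he1 with h0 | h1
        · rw [h0, add_zero, div_self (by positivity)]; simp
        · have hm : (0 : ℝ) < m + 1 + e := by positivity
          rw [← mul_div_assoc, le_div_iff₀ hm, ← sub_nonneg]
          have h4 : (1 - e * k / n) * (m + 1) - (1 - e * ((k + 1 : ℕ) : ℝ) / n) * (m + 1 + e) =
              e * (e * k + e - k) / n := by
            rw [hnn] at hn0 ⊢
            push_cast
            field_simp
            ring
          rw [h4]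
          have hk0 : (0 : ℝ) ≤ k := Nat.cast_nonneg k
          have : (0 : ℝ) ≤ e * k + e - k := by nlinarith
          positivity
      rw [hr]
      linarith

end Marginal

/-! ### Concatenated and paired words -/

section Words

variable {D : Type*}

/-- The concatenation of a word of length `k` and a word of length `n - k`. -/
def joinWord {n k : ℕ} (hk : k ≤ n) (i : Fin k → D) (l : Fin (n - k) → D) : Fin n → D :=
  fun t => Fin.append i l (Fin.cast (Nat.add_sub_of_le hk).symm t)

theorem bijective_joinWord {n k : ℕ} (hk : k ≤ n) :
    Function.Bijective (Function.uncurry (joinWord (D := D) hk)) :=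
  ((Fin.appendEquiv k (n - k)).trans
    ((finCongr (Nat.add_sub_of_le hk)).arrowCongr (Equiv.refl D))).bijective

theorem prod_joinWord {n k : ℕ} (hk : k ≤ n) (i : Fin k → D) (l : Fin (n - k) → D) (f : D → ℂ) :
    ∏ t, f (joinWord hk i l t) = (∏ t, f (i t)) * ∏ t, f (l t) := by
  have h := (finCongr (Nat.add_sub_of_le hk).symm).prod_comp fun t => f (Fin.append i l t)
  rw [Fin.prod_univ_add] at h
  simp only [Fin.append_left, Fin.append_right] at h
  exact h

theorem exists_perm_joinWord {n k : ℕ} (hk : k ≤ n) (i : Fin k → D) (l : Fin (n - k) → D)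
    (π : Equiv.Perm (Fin (n - k))) :
    ∃ ρ : Equiv.Perm (Fin n), joinWord hk i (l ∘ π) = joinWord hk i l ∘ ρ := by
  have hn := Nat.add_sub_of_le hk
  refine ⟨(finSumFinEquiv.trans (finCongr hn)).permCongr (Equiv.sumCongr (Equiv.refl _) π), ?_⟩
  funext t
  obtain ⟨x, rfl⟩ := (finSumFinEquiv.trans (finCongr hn)).surjective t
  rw [Function.comp_apply, Equiv.permCongr_apply, Equiv.symm_apply_apply]
  rcases x with x | x <;> simp [joinWord]

/-- The word of pairs of letters of two words. -/
def pairWord {D' : Type*} {n : ℕ} (i : Fin n → D) (j : Fin n → D') : Fin n → D × D' :=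
  fun t => (i t, j t)

theorem bijective_pairWord {D' : Type*} {n : ℕ} :
    Function.Bijective (Function.uncurry (pairWord (D := D) (D' := D') (n := n))) :=
  (Equiv.arrowProdEquivProdArrow (Fin n) (fun _ => D) (fun _ => D')).symm.bijective

theorem joinWord_pairWord {D' : Type*} {n k : ℕ} (hk : k ≤ n) (i : Fin k → D) (j : Fin k → D')
    (l : Fin (n - k) → D) (m : Fin (n - k) → D') :
    joinWord hk (pairWord i j) (pairWord l m) = pairWord (joinWord hk i l) (joinWord hk j m) := by
  funext t
  obtain ⟨x, rfl⟩ := (finCongr (Nat.add_sub_of_le hk)).surjective t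
  induction x using Fin.addCases <;> simp [joinWord, pairWord]

/-- The matrix `permCount i j / n!` is the average of the permutation operators, so it fixes every
invariant `F`. -/
theorem sum_permCount_smul {α : Type*} [Fintype α] [DecidableEq α] [Fintype D] [DecidableEq D]
    {M : Type*} [AddCommGroup M] [Module ℂ M] {F : (α → D) → M}
    (hF : ∀ (π : Equiv.Perm α) i, F (i ∘ π) = F i) (i : α → D) :
    ∑ j, ((permCount i j : ℂ) / (Fintype.card α).factorial) • F j = F i := by
  have h : ∀ j, ((permCount i j : ℂ) / (Fintype.card α).factorial) • F j =
      ∑ π : Equiv.Perm α, if i ∘ π = j then ((Fintype.card α).factorial : ℂ)⁻¹ • F j else 0 := by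
    intro j
    rw [permCount, Nat.cast_sum, div_eq_mul_inv, Finset.sum_mul, Finset.sum_smul]
    refine Finset.sum_congr rfl fun π _ => ?_
    split_ifs <;> simp
  simp only [h]
  rw [Finset.sum_comm]
  simp only [Finset.sum_ite_eq, Finset.mem_univ, if_true, hF]
  rw [Finset.sum_const, Finset.card_univ, Fintype.card_perm, ← Nat.cast_smul_eq_nsmul ℂ, smul_smul,
    mul_inv_cancel₀ (by exact_mod_cast Nat.factorial_ne_zero _), one_smul]

end Words

/-! ### Bose-symmetric states over a finite alphabet -/

section Bose

variable {H : Type*} [NormedAddCommGroup H] [InnerProductSpace ℂ H] [CompleteSpace H]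

theorem IsDensityOperator.nonempty_index {ι : Type*} [Fintype ι]
    {T : PiLp 2 (fun _ : ι => H) →L[ℂ] PiLp 2 (fun _ : ι => H)} (hT : IsDensityOperator T) :
    Nonempty ι := by
  by_contra h
  rw [not_nonempty_iff] at h
  have := hT.trace_eq_one
  rw [posTrace_eq_sum_block hT.isPositive] at this
  simp at this

/-- The alphabet `D` is arbitrary because both `Fin d` and `Fin d × Fin d` are needed. The output
keeps `P` and `Q` rather than a distance, so that a further partial trace can be applied to them. -/
theorem exists_mixture_of_bose {D : Type*} [Fintype D] [DecidableEq D] {n k : ℕ} (hn : 0 < n)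
    (hk : k ≤ n)
    {T : PiLp 2 (fun _ : Fin n → D => H) →L[ℂ] PiLp 2 (fun _ : Fin n → D => H)}
    (hT : IsDensityOperator T)
    (hsymm : ∀ (π : Equiv.Perm (Fin n)) i j, block T (i ∘ π) j = block T i j) :
    ∃ (S : Type) (_ : Fintype S) (A : S → H →L[ℂ] H) (φ : S → D → ℂ)
      (τ P Q : PiLp 2 (fun _ : Fin k → D => H) →L[ℂ] PiLp 2 (fun _ : Fin k → D => H)),
      (∀ s, (A s).IsPositive) ∧ ∑ s, posTrace (A s) = 1 ∧
      (∀ s, ∑ a, φ s a * star (φ s a) = 1) ∧ IsDensityOperator τ ∧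
      (∀ i j, block τ i j = ∑ s, ketbraPower (Fin k) (φ s) i j • A s) ∧
      P.IsPositive ∧ Q.IsPositive ∧ partialTraceAlong (joinWord hk) T - τ = P - Q ∧
      posTrace P + posTrace Q ≤ ENNReal.ofReal (4 * ((Fintype.card D : ℝ) * k / n)) := by
  obtain ⟨word⟩ := hT.nonempty_index
  have : Nonempty (Fin n) := ⟨⟨0, hn⟩⟩
  have : Nonempty D := ⟨word ⟨0, hn⟩⟩
  obtain ⟨S, hS, w, φ, hw, hφ, hdes⟩ := exists_design (α := Fin n) (D := D)
  rw [Fintype.card_fin] at hdes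
  obtain ⟨c, hc, hcn, hmarg⟩ := design_marginal hφ hdes k (n - k) (Nat.add_sub_of_le hk)
  have hket : ∀ {m : ℕ} s (i j : Fin m → D),
      (∏ t, φ s (i t)) * star (∏ t, φ s (j t)) = ketbraPower (Fin m) (φ s) i j := by
    intro m s i j
    rw [ketbraPower, Finset.prod_mul_distrib, star_prod]
  obtain ⟨A, τ, P, Q, hA, hA1, hτ, hτb, hP, hQ, hPQ, hle⟩ := exists_mixture_sub
    (bijective_joinWord hk) hw (u := fun s i => ∏ t, φ s (i t)) (v := fun s l => ∏ t, φ s (l t))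
    (Ψ := fun s a => ∏ t, φ s (a t)) (fun s i l => prod_joinWord hk i l (φ s))
    (fun s => by
      simp only [hket]
      rw [sum_ketbraPower_self, hφ, one_pow]) hc hT
    (fun a b => by
      simp only [hket]
      rw [Finset.sum_comm]
      simp only [← Finset.sum_smul, hdes]
      have := sum_permCount_smul (F := fun a => block T a b) (fun π i => hsymm π i b) a
      rwa [Fintype.card_fin] at this)
    (fun i l b => by
      simp only [hket]
      rw [Finset.sum_comm]
      simp only [← Finset.sum_smul, hmarg]
      simp only [mul_smul]
      rw [← Finset.smul_sum]
      -- Permutations of the last n - k positions extend to all n positions, so the symmetry of `T`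
      -- applies to the suffix alone.
      have := sum_permCount_smul (F := fun l => block T (joinWord hk i l) b) (fun π l => by
        obtain ⟨ρ, hρ⟩ := exists_perm_joinWord hk i l π
        rw [hρ, hsymm]) l
      rw [Fintype.card_fin] at this
      rw [this])
  refine ⟨S, hS, A, φ, τ, P, Q, hA, hA1, hφ, hτ, fun i j => ?_, hP, hQ, hPQ,
    hle.trans (ENNReal.ofReal_le_ofReal ?_)⟩
  · rw [hτb]
    simp only [hket]
  · have h0 : (0 : ℝ) ≤ k / n := by positivity
    have h1 : ((Fintype.card D : ℝ) - 1) * k / n ≤ (Fintype.card D : ℝ) * k / n := by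
      rw [mul_div_assoc, mul_div_assoc]
      nlinarith
    linarith

end Bose

/-! ### Finite mixtures as integrals, and part (b) -/

section Final

open MeasureTheory

variable {H : Type*} [NormedAddCommGroup H] [InnerProductSpace ℂ H] [CompleteSpace H]

theorem eq_zero_of_posTrace_eq_zero {X : Type*} [NormedAddCommGroup X] [InnerProductSpace ℂ X]
    [CompleteSpace X] {T : X →L[ℂ] X} (hT : T.IsPositive) (h : posTrace T = 0) : T = 0 := by
  have h0 : 0 ≤ T := (ContinuousLinearMap.nonneg_iff_isPositive T).2 hT
  have hs : ContinuousLinearMap.adjoint (CFC.sqrt T) = CFC.sqrt T :=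
    (CFC.sqrt_nonneg T).isSelfAdjoint
  have hsq : CFC.sqrt T * CFC.sqrt T = T := CFC.sqrt_mul_sqrt_self T h0
  have hb : ∀ i, CFC.sqrt T (someBasis X i) = 0 := by
    intro i
    have h1 : (⟪someBasis X i, T (someBasis X i)⟫_ℂ).re ≤ 0 :=
      ENNReal.ofReal_eq_zero.1 (ENNReal.tsum_eq_zero.1 h i)
    rw [← hsq, mul_apply_eq_comp, ← ContinuousLinearMap.adjoint_inner_left, hs,
      inner_self_eq_norm_sq_to_K] at h1
    have h2 : ‖CFC.sqrt T (someBasis X i)‖ ^ 2 ≤ 0 := by exact_mod_cast h1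
    exact norm_eq_zero.1 (pow_eq_zero_iff two_ne_zero |>.1 (le_antisymm h2 (by positivity)))
  have hz : CFC.sqrt T = 0 := by
    refine ContinuousLinearMap.ext_on
      ((Submodule.dense_iff_topologicalClosure_eq_top).2 (someBasis X).dense_span) ?_
    rintro _ ⟨i, rfl⟩
    rw [hb]; rfl
  rw [← hsq, hz, mul_zero]

theorem block_tensorPower {d k : ℕ} (A : H →L[ℂ] H) (σ : Matrix (Fin d) (Fin d) ℂ)
    (i j : Fin k → Fin d) :
    block (tensorPower k A σ) i j = (∏ t, σ (i t) (j t)) • A := by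
  ext x
  change tensorPower k A σ (ContinuousLinearMap.adjoint (coord H j) x) i = _
  rw [tensorPower_apply, adjoint_coord_apply, Finset.sum_eq_single j]
  · simp
  · intro b _ hb
    simp [hb]
  · simp

theorem tensorPower_sum {d k : ℕ} {S : Type*} (s : Finset S) (A : S → H →L[ℂ] H)
    (σ : Matrix (Fin d) (Fin d) ℂ) :
    tensorPower k (∑ x ∈ s, A x) σ = ∑ x ∈ s, tensorPower k (A x) σ := by
  refine ext_block fun i j => ?_
  simp only [block_sum, block_tensorPower, Finset.smul_sum]

theorem tensorPower_smul {d k : ℕ} (c : ℝ) (A : H →L[ℂ] H) (σ : Matrix (Fin d) (Fin d) ℂ) :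
    tensorPower k ((c : ℂ) • A) σ = c • tensorPower k A σ := by
  have : c • tensorPower k A σ = (c : ℂ) • tensorPower k A σ := by
    ext; simp
  rw [this]
  refine ext_block fun i j => ?_
  simp only [block_smul, block_tensorPower]
  exact smul_comm _ _ _

instance (d : ℕ) : T1Space (DensityMatrix d) :=
  inferInstanceAs (T1Space {σ : Matrix (Fin d) (Fin d) ℂ // σ.PosSemidef ∧ σ.trace = 1})

-- The measure is ∑ tr(A_s) δ_{σ_s}. Several `s` may share one state σ, so the family at σ is the
-- normalised sum of the corresponding `A s`.
set_option synthInstance.maxHeartbeats 200000 in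
theorem mem_productMixtures_of_finite {d k : ℕ} {S : Type*} [Fintype S] {A : S → H →L[ℂ] H}
    (hA : ∀ s, (A s).IsPositive) (hA1 : ∑ s, posTrace (A s) = 1) (σ : S → DensityMatrix d)
    {τ : System H d k →L[ℂ] System H d k} (hτ : IsDensityOperator τ)
    (hblock : ∀ i j, block τ i j = ∑ s, (∏ t, (σ s).1 (i t) (j t)) • A s) :
    τ ∈ productMixtures H d k := by
  classical
  have hτsum : τ = ∑ s, tensorPower k (A s) (σ s).1 := by
    refine ext_block fun i j => ?_
    simp only [hblock, block_sum, block_tensorPower]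
  have hfin : ∀ s, posTrace (A s) ≠ ∞ := fun s => by
    have : posTrace (A s) ≤ 1 := by
      rw [← hA1]; exact Finset.single_le_sum (f := fun s => posTrace (A s)) (fun _ _ => bot_le) (Finset.mem_univ s)
    exact (this.trans_lt ENNReal.one_lt_top).ne
  have hnorm : ∀ T : H →L[ℂ] H, T.IsPositive → posTrace T ≠ ∞ → posTrace T ≠ 0 →
      IsDensityOperator ((((posTrace T).toReal⁻¹ : ℝ) : ℂ) • T) := by
    intro T hT h1 h0
    refine ⟨isPositive_ofReal_smul (by positivity) hT, ?_⟩
    rw [posTrace_smul (by positivity), ENNReal.ofReal_inv_of_pos (ENNReal.toReal_pos h0 h1),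
      ENNReal.ofReal_toReal h1, ENNReal.inv_mul_cancel h0 h1]
  obtain ⟨ρ, hρ⟩ : ∃ ρ : H →L[ℂ] H, IsDensityOperator ρ := by
    obtain ⟨s, -, hs⟩ : ∃ s ∈ Finset.univ, posTrace (A s) ≠ 0 :=
      Finset.exists_ne_zero_of_sum_ne_zero (by rw [hA1]; exact one_ne_zero)
    exact ⟨_, hnorm _ (hA s) (hfin s) hs⟩
  set B : DensityMatrix d → H →L[ℂ] H := fun x => ∑ s with σ s = x, A s with hB
  have hBpos : ∀ x, (B x).IsPositive := fun x => ContinuousLinearMap.isPositive_sum _ fun s _ => hA s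
  have hBtr : ∀ x, posTrace (B x) = ∑ s with σ s = x, posTrace (A s) := fun x =>
    posTrace_sum _ _ fun s _ => hA s
  have hBfin : ∀ x, posTrace (B x) ≠ ∞ := fun x => by
    rw [hBtr]; exact ENNReal.sum_ne_top.2 fun s _ => hfin s
  -- Where the weight vanishes the family takes the fixed state `ρ`, since it must be a state for
  -- every σ. It equals `ρ` off a finite set, hence is measurable.
  set ζ : DensityMatrix d → H →L[ℂ] H := fun x =>
    if posTrace (B x) = 0 then ρ else (((posTrace (B x)).toReal⁻¹ : ℝ) : ℂ) • B x with hζ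
  have hζdens : ∀ x, IsDensityOperator (ζ x) := by
    intro x
    simp only [hζ]
    split_ifs with h
    · exact hρ
    · exact hnorm _ (hBpos x) (hBfin x) h
  have hζB : ∀ x, (((posTrace (B x)).toReal : ℝ) : ℂ) • ζ x = B x := by
    intro x
    simp only [hζ]
    split_ifs with h
    · rw [eq_zero_of_posTrace_eq_zero (hBpos x) h, posTrace_zero]
      simp
    · rw [smul_smul, ← Complex.ofReal_mul,
        mul_inv_cancel₀ (ENNReal.toReal_pos h (hBfin x)).ne', Complex.ofReal_one, one_smul]
  set F : Finset (DensityMatrix d) := Finset.univ.image σ with hF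
  have hζout : ∀ x ∉ F, ζ x = ρ := by
    intro x hx
    have : B x = 0 := by
      refine Finset.sum_eq_zero fun s hs => absurd ?_ hx
      rw [← (Finset.mem_filter.1 hs).2]
      exact Finset.mem_image_of_mem _ (Finset.mem_univ s)
    simp only [hζ, this, posTrace_zero, if_true]
  have hζmeas : StronglyMeasurable ζ := by
    have : ζ = fun x => ρ + ∑ y ∈ F, ({y} : Set (DensityMatrix d)).indicator
        (fun _ => ζ y - ρ) x := by
      funext x
      simp only [Set.indicator_apply, Set.mem_singleton_iff, Finset.sum_ite_eq]
      split_ifs with hx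
      · abel
      · rw [hζout x hx, add_zero]
    rw [this]
    exact stronglyMeasurable_const.add (Finset.stronglyMeasurable_fun_sum _ fun y _ =>
      stronglyMeasurable_const.indicator (measurableSet_singleton y))
  set m : Measure (DensityMatrix d) := ∑ s, posTrace (A s) • Measure.dirac (σ s) with hm
  refine ⟨hτ, m, ζ, ⟨by simp [hm, hA1]⟩, hζmeas, hζdens, ?_⟩
  rw [hm, integral_finsetSum_measure fun s _ =>
    (integrable_dirac (by exact enorm_lt_top)).smul_measure (hfin s)]
  simp only [integral_smul_measure, integral_dirac]
  rw [hτsum, ← Finset.sum_fiberwise_of_maps_to (t := F) (g := σ)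
      fun s _ => Finset.mem_image_of_mem _ (Finset.mem_univ s),
    ← Finset.sum_fiberwise_of_maps_to (t := F) (g := σ) (f := fun s =>
      (posTrace (A s)).toReal • tensorPower k (ζ (σ s)) (σ s).1)
      fun s _ => Finset.mem_image_of_mem _ (Finset.mem_univ s)]
  refine Finset.sum_congr rfl fun x _ => ?_
  have h1 : ∑ s with σ s = x, tensorPower k (A s) (σ s).1 = tensorPower k (B x) x.1 := by
    rw [hB, tensorPower_sum]
    exact Finset.sum_congr rfl fun s hs => by rw [(Finset.mem_filter.1 hs).2]
  have h2 : ∑ s with σ s = x, (posTrace (A s)).toReal • tensorPower k (ζ (σ s)) (σ s).1 =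
      (posTrace (B x)).toReal • tensorPower k (ζ x) x.1 := by
    rw [hBtr, ENNReal.toReal_sum fun s _ => hfin s]
    exact (Finset.sum_congr rfl fun s hs => by rw [(Finset.mem_filter.1 hs).2]).trans
      Finset.sum_smul.symm
  rw [h1, h2, ← tensorPower_smul, hζB]

theorem traceDist_le_of_sub_eq {X : Type*} [NormedAddCommGroup X] [InnerProductSpace ℂ X]
    [CompleteSpace X] {S T P Q : X →L[ℂ] X} (hP : P.IsPositive) (hQ : Q.IsPositive)
    (h : S - T = P - Q) {x : ℝ} (hle : posTrace P + posTrace Q ≤ ENNReal.ofReal (4 * x)) :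
    traceDist S T ≤ ENNReal.ofReal (2 * x) := by
  rw [traceDist, h]
  refine ENNReal.div_le_of_le_mul (((posTrace_abs_sub_le hP hQ).trans hle).trans_eq ?_)
  rw [← ENNReal.ofReal_ofNat 2, ← ENNReal.ofReal_mul' (by norm_num)]
  congr 1; ring

theorem partialTrace_eq_partialTraceAlong {d n k : ℕ} (hk : k ≤ n)
    (ξ : System H d n →L[ℂ] System H d n) :
    partialTrace hk ξ = partialTraceAlong (joinWord hk) ξ := rfl

/-- The projection onto a unit vector, as a density matrix. -/
theorem ketbra_isDensity {d : ℕ} {φ : Fin d → ℂ} (hφ : ∑ a, φ a * star (φ a) = 1) :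
    (Matrix.vecMulVec φ (star φ)).PosSemidef ∧ (Matrix.vecMulVec φ (star φ)).trace = 1 :=
  ⟨Matrix.posSemidef_vecMulVec_self_star φ, by rw [← hφ]; rfl⟩

theorem exists_productMixture_of_bose {d n k : ℕ} (hn : 0 < n) (hk : k ≤ n)
    {ξ : System H d n →L[ℂ] System H d n} (hξ : IsDensityOperator ξ)
    (hsymm : IsBoseSymmetricRel ξ) :
    ∃ τ ∈ productMixtures H d k, traceDist (partialTrace hk ξ) τ ≤
      ENNReal.ofReal (2 * ((d : ℝ) * (k : ℝ) / (n : ℝ))) := by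
  obtain ⟨S, hS, A, φ, τ, P, Q, hA, hA1, hφ, hτ, hb, hP, hQ, hPQ, hle⟩ :=
    exists_mixture_of_bose hn hk hξ fun π i j => by
      conv_rhs => rw [← hsymm π]
      rfl
  refine ⟨τ, mem_productMixtures_of_finite hA hA1 (fun s => ⟨_, ketbra_isDensity (hφ s)⟩) hτ hb, ?_⟩
  rw [Fintype.card_fin] at hle
  exact traceDist_le_of_sub_eq hP hQ hPQ hle

end Final

/-! ### Bose-symmetric extension, and part (a) -/

section Symmetric

variable {H : Type*} [NormedAddCommGroup H] [InnerProductSpace ℂ H] [CompleteSpace H]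

theorem block_comp_comp_adjoint {ι : Type*} [Fintype ι]
    (U R : PiLp 2 (fun _ : ι => H) →L[ℂ] PiLp 2 (fun _ : ι => H)) (f : ι → ι)
    (hU : ∀ i, coord H i ∘L U = coord H (f i)) (i j : ι) :
    block (U ∘L R ∘L ContinuousLinearMap.adjoint U) i j = block R (f i) (f j) := by
  unfold block
  rw [← hU i, ← hU j, ContinuousLinearMap.adjoint_comp]
  rfl

/-- The conjugate of √T is a positive square root of T, and that root is unique. -/
theorem conj_sqrt_of_isometry {X : Type*} [NormedAddCommGroup X] [InnerProductSpace ℂ X]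
    [CompleteSpace X] {U T : X →L[ℂ] X} (hT : T.IsPositive)
    (hU : ContinuousLinearMap.adjoint U ∘L U = 1)
    (h : U ∘L T ∘L ContinuousLinearMap.adjoint U = T) :
    U ∘L CFC.sqrt T ∘L ContinuousLinearMap.adjoint U = CFC.sqrt T := by
  have h0 : 0 ≤ T := (ContinuousLinearMap.nonneg_iff_isPositive T).2 hT
  have hR : (CFC.sqrt T).IsPositive :=
    (ContinuousLinearMap.nonneg_iff_isPositive _).1 (CFC.sqrt_nonneg T)
  have hsq : CFC.sqrt T ∘L CFC.sqrt T = T := CFC.sqrt_mul_sqrt_self T h0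
  symm
  refine CFC.sqrt_unique ?_ ((ContinuousLinearMap.nonneg_iff_isPositive _).2 (hR.conj_adjoint U))
  calc (U ∘L CFC.sqrt T ∘L ContinuousLinearMap.adjoint U) *
        (U ∘L CFC.sqrt T ∘L ContinuousLinearMap.adjoint U)
      = U ∘L CFC.sqrt T ∘L (ContinuousLinearMap.adjoint U ∘L U) ∘L CFC.sqrt T ∘L
          ContinuousLinearMap.adjoint U := rfl
    _ = U ∘L (CFC.sqrt T ∘L CFC.sqrt T) ∘L ContinuousLinearMap.adjoint U := by rw [hU]; rfl
    _ = T := by rw [hsq, h]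

omit [CompleteSpace H] in
theorem norm_permOp {d n : ℕ} (π : Equiv.Perm (Fin n)) (x : System H d n) :
    ‖permOp π x‖ = ‖x‖ :=
  LinearIsometryEquiv.norm_map
    (LinearIsometryEquiv.piLpCongrLeft 2 ℂ H (π.arrowCongr (Equiv.refl (Fin d)))) x

theorem block_sqrt_comp {d n : ℕ} {ξ : System H d n →L[ℂ] System H d n} (hξ : ξ.IsPositive)
    (hsymm : IsSymmetricRel ξ) (π : Equiv.Perm (Fin n)) (i j : Fin n → Fin d) :
    block (CFC.sqrt ξ) (i ∘ π) (j ∘ π) = block (CFC.sqrt ξ) i j := by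
  have hU := (ContinuousLinearMap.norm_map_iff_adjoint_comp_self
    (permOp π : System H d n →L[ℂ] System H d n)).1 (norm_permOp π)
  conv_rhs => rw [← conj_sqrt_of_isometry hξ hU (hsymm π)]
  exact (block_comp_comp_adjoint _ _ (fun i => i ∘ π) (fun _ => rfl) i j).symm

/-- A state that is permutation-invariant relative to `H` extends to one on
`H ⊗ (ℂ^d ⊗ ℂ^d)^{⊗ n}` that is Bose-symmetric relative to `H`. -/
theorem exists_bose_extension {d n : ℕ} {ξ : System H d n →L[ℂ] System H d n}
    (hξ : IsDensityOperator ξ) (hsymm : IsSymmetricRel ξ) :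
    ∃ T : PiLp 2 (fun _ : Fin n → Fin d × Fin d => H) →L[ℂ]
        PiLp 2 (fun _ : Fin n → Fin d × Fin d => H),
      IsDensityOperator T ∧ (∀ (π : Equiv.Perm (Fin n)) i j, block T (i ∘ π) j = block T i j) ∧
      partialTraceAlong pairWord T = ξ := by
  have h0 : 0 ≤ ξ := (ContinuousLinearMap.nonneg_iff_isPositive ξ).2 hξ.isPositive
  have hadj : ContinuousLinearMap.adjoint (CFC.sqrt ξ) = CFC.sqrt ξ :=
    (CFC.sqrt_nonneg ξ).isSelfAdjoint
  have hsq : CFC.sqrt ξ ∘L CFC.sqrt ξ = ξ := CFC.sqrt_mul_sqrt_self ξ h0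
  have hinv := block_sqrt_comp hξ.isPositive hsymm
  set R := CFC.sqrt ξ with hR
  -- Vectorisation of √ξ in its (ℂ^d)^{⊗n} indices only: row and column letters become pairs, while
  -- H stays an operator space. The extension is V V†.
  set V : H →L[ℂ] PiLp 2 (fun _ : Fin n → Fin d × Fin d => H) :=
    ∑ w, ContinuousLinearMap.adjoint (coord H w) ∘L
      block R (fun t => (w t).1) (fun t => (w t).2) with hV
  have hcV : ∀ w, coord H w ∘L V = block R (fun t => (w t).1) (fun t => (w t).2) := by
    intro w
    rw [hV, ContinuousLinearMap.comp_finsetSum, Finset.sum_eq_single w]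
    · rw [← ContinuousLinearMap.comp_assoc, coord_comp_adjoint_coord, if_pos rfl]; rfl
    · intro b _ hb
      rw [← ContinuousLinearMap.comp_assoc, coord_comp_adjoint_coord, if_neg hb.symm]; simp
    · simp
  have hblock : ∀ i j, block (V ∘L ContinuousLinearMap.adjoint V) i j =
      block R (fun t => (i t).1) (fun t => (i t).2) ∘L
        ContinuousLinearMap.adjoint (block R (fun t => (j t).1) (fun t => (j t).2)) := by
    intro i j
    rw [← hcV, ← hcV, ContinuousLinearMap.adjoint_comp]
    rfl
  have hpos : (V ∘L ContinuousLinearMap.adjoint V).IsPositive :=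
    ContinuousLinearMap.isPositive_self_comp_adjoint V
  -- Blockwise, ∑_l R_{il} (R_{jl})† = ∑_l R_{il} R_{lj} = ξ_{ij}, as R is self-adjoint.
  have hpt : partialTraceAlong pairWord (V ∘L ContinuousLinearMap.adjoint V) = ξ := by
    refine ext_block fun i j => ?_
    rw [block_partialTraceAlong, ← hsq, block_comp]
    refine Finset.sum_congr rfl fun l _ => ?_
    rw [hblock, ← block_adjoint, hadj]
    rfl
  refine ⟨V ∘L ContinuousLinearMap.adjoint V, ⟨hpos, ?_⟩, fun π i j => ?_, hpt⟩
  · rw [← posTrace_partialTraceAlong bijective_pairWord hpos, hpt, hξ.trace_eq_one]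
  -- Permuting pairs permutes rows and columns of √ξ simultaneously, which leaves its blocks
  -- unchanged; this gives one-sided invariance of V V†.
  · have h : block R (fun t => ((i ∘ π) t).1) (fun t => ((i ∘ π) t).2) =
        block R (fun t => (i t).1) (fun t => (i t).2) :=
      hinv π (fun t => (i t).1) (fun t => (i t).2)
    rw [hblock, hblock, h]

theorem partialTraceAlong_sub {ι κ μ : Type*} [Fintype ι] [Fintype κ] [Fintype μ]
    (e : κ → μ → ι) (S T : PiLp 2 (fun _ : ι => H) →L[ℂ] PiLp 2 (fun _ : ι => H)) :
    partialTraceAlong e (S - T) = partialTraceAlong e S - partialTraceAlong e T := by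
  refine ext_block fun i j => ?_
  simp only [block_partialTraceAlong, block_sub, Finset.sum_sub_distrib]

/-- The reduced density matrix of a unit vector of `ℂ^d ⊗ ℂ^d`. -/
theorem reduced_isDensity {d : ℕ} {φ : Fin d × Fin d → ℂ} (hφ : ∑ a, φ a * star (φ a) = 1) :
    (Matrix.of (Function.curry φ) * (Matrix.of (Function.curry φ)).conjTranspose).PosSemidef ∧
      (Matrix.of (Function.curry φ) * (Matrix.of (Function.curry φ)).conjTranspose).trace = 1 :=
  ⟨Matrix.posSemidef_self_mul_conjTranspose _, by
    rw [← hφ, Fintype.sum_prod_type]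
    simp [Matrix.trace, Matrix.mul_apply, Function.curry]⟩

theorem sum_ketbraPower_pairWord {d k : ℕ} (φ : Fin d × Fin d → ℂ) (i j : Fin k → Fin d) :
    ∑ l : Fin k → Fin d, ketbraPower (Fin k) φ (pairWord i l) (pairWord j l) =
      ∏ t, (Matrix.of (Function.curry φ) *
        (Matrix.of (Function.curry φ)).conjTranspose) (i t) (j t) := by
  simp only [ketbraPower, pairWord, Matrix.mul_apply, Matrix.conjTranspose_apply, Matrix.of_apply,
    Function.curry]
  rw [Finset.prod_univ_sum, Fintype.piFinset_univ]

/-- The pair alphabet has d² letters, whence the d². Tracing out the second letters preserves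
positivity and traces, so the bound on `P` and `Q` carries over. -/
theorem exists_productMixture_of_symmetric {d n k : ℕ} (hn : 0 < n) (hk : k ≤ n)
    {ξ : System H d n →L[ℂ] System H d n} (hξ : IsDensityOperator ξ)
    (hsymm : IsSymmetricRel ξ) :
    ∃ τ ∈ productMixtures H d k, traceDist (partialTrace hk ξ) τ ≤
      ENNReal.ofReal (2 * ((d : ℝ) ^ 2 * (k : ℝ) / (n : ℝ))) := by
  obtain ⟨T, hT, hTsymm, hTξ⟩ := exists_bose_extension hξ hsymm
  obtain ⟨S, hS, A, φ, τ, P, Q, hA, hA1, hφ, hτ, hb, hP, hQ, hPQ, hle⟩ :=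
    exists_mixture_of_bose hn hk hT hTsymm
  -- Discarding the last n - k pairs and discarding the second letters commute.
  have hcomm : partialTraceAlong pairWord (partialTraceAlong (joinWord hk) T) =
      partialTrace hk ξ := by
    rw [partialTrace_eq_partialTraceAlong, ← hTξ]
    refine ext_block fun i j => ?_
    simp only [block_partialTraceAlong]
    have h1 : ∀ l, ∑ m, block T (pairWord (joinWord hk i l) m) (pairWord (joinWord hk j l) m) =
        ∑ a, ∑ b, block T (joinWord hk (pairWord i a) (pairWord l b))
          (joinWord hk (pairWord j a) (pairWord l b)) := by
      intro l
      rw [← (bijective_joinWord hk).sum_comp, Fintype.sum_prod_type]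
      simp only [joinWord_pairWord, Function.uncurry_apply_pair]
    simp only [h1]
    conv_rhs => rw [Finset.sum_comm]
    refine Finset.sum_congr rfl fun a _ => ?_
    rw [← bijective_pairWord.sum_comp, Fintype.sum_prod_type]
    rfl
  refine ⟨partialTraceAlong pairWord τ, mem_productMixtures_of_finite hA hA1
    (fun s => ⟨_, reduced_isDensity (hφ s)⟩) ⟨isPositive_partialTraceAlong _ hτ.isPositive, ?_⟩
    fun i j => ?_, traceDist_le_of_sub_eq (isPositive_partialTraceAlong pairWord hP)
      (isPositive_partialTraceAlong pairWord hQ) ?_ ?_⟩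
  · rw [posTrace_partialTraceAlong bijective_pairWord hτ.isPositive, hτ.trace_eq_one]
  · rw [block_partialTraceAlong]
    simp only [hb]
    rw [Finset.sum_comm]
    refine Finset.sum_congr rfl fun s _ => ?_
    rw [← Finset.sum_smul, sum_ketbraPower_pairWord]
  · rw [← hcomm, ← partialTraceAlong_sub, hPQ, partialTraceAlong_sub]
  · rw [posTrace_partialTraceAlong bijective_pairWord hP,
      posTrace_partialTraceAlong bijective_pairWord hQ]
    refine hle.trans_eq ?_
    rw [Fintype.card_prod, Fintype.card_fin]
    push_cast
    rw [sq]

end Symmetric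

end DeFinetti

end

theorem mainTheorem11 {H : Type*} [NormedAddCommGroup H] [InnerProductSpace ℂ H]
    [CompleteSpace H] (d n k : ℕ) (hn : 0 < n) (hk : k ≤ n)
    (ξ : DeFinetti.System H d n →L[ℂ] DeFinetti.System H d n)
    (hξ : DeFinetti.IsDensityOperator ξ) :
    (DeFinetti.IsSymmetricRel ξ →
      ∃ τ ∈ DeFinetti.productMixtures H d k,
        DeFinetti.traceDist (DeFinetti.partialTrace hk ξ) τ ≤
          ENNReal.ofReal (2 * ((d : ℝ) ^ 2 * (k : ℝ) / (n : ℝ)))) ∧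
    (DeFinetti.IsBoseSymmetricRel ξ →
      ∃ τ ∈ DeFinetti.productMixtures H d k,
        DeFinetti.traceDist (DeFinetti.partialTrace hk ξ) τ ≤
          ENNReal.ofReal (2 * ((d : ℝ) * (k : ℝ) / (n : ℝ)))) := by
  exact ⟨DeFinetti.exists_productMixture_of_symmetric hn hk hξ,
    DeFinetti.exists_productMixture_of_bose hn hk hξ⟩
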